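/- **Conventions.** Let $k$ be a field, $D=\operatorname{Hom}_k(-,k)$, and let $\mathcal A$ be a Hom-finite $k$-linear additive category. For a $k$-linear category $\mathcal C$, let $\mathsf{Mod}\,\mathcal C$ be the abelian category of contravariant $k$-linear functors from $\mathcal C$ to $k$-vector spaces. Let $\mathsf{proj}\,\mathcal C$ be the full subcategory of projective objects of $\mathsf{Mod}\,\mathcal C$ that are quotients of finite direct sums of representables $\mathcal C(-,X)$, and let $\mathsf{mod}\,\mathcal C$ be the full subcategory of modules $M$ having an exact resolution $\cdots\to P_1\to P_0\to M\to0$ with all $P_i\in\mathsf{proj}\,\mathcal C$. Put $M^*(X)=\operatorname{Hom}(M,\mathcal C(-,X))$. A module is *Gorenstein-projective* if it is isomorphic to the image of $d_0$ in an acyclic complex $(P_i,d_i:P_i\to P_{i+1})_{i\in\mathbb Z}$ with all $P_i\in\mathsf{proj}\,\mathcal C$ such that the complex $\cdots\to P_{i+1}^*\to P_i^*\to P_{i-1}^*\to\cdots$ is acyclic too; $\mathsf{GP}(\mathcal C)$ is the full subcategory of these modules. Consider the conditions * (IFP) $D\mathcal A(X,-)\in\mathsf{mod}\,\mathcal A$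 for every $X\in\mathcal A$; * (G) $D\mathcal A(X,-)$ has finite projective dimension over $\mathcal A$ for every $X\in\mathcal A$. The *repetitive category* $\mathsf R\mathcal A$ has objects the pairs $(X,i)$ with $X\in\mathcal A$, $i\in\mathbb Z$ (and their formal finite direct sums, which do not affect modules), with morphism spaces $\mathcal A(X,Y)$ from $(X,i)$ to $(Y,j)$ if $j=i$, $D\mathcal A(Y,X)$ if $j=i+1$, and $0$ otherwise; composition is that of $\mathcal A$ together with the action of $\mathcal A$ on $D\mathcal A$, a composite of two morphisms of the second kind being $0$. For $X\in\mathcal A$ let $\mathcal A_0(-,X)$ be the $\mathsf R\mathcal A$-module with value $\mathcal A(Y,X)$ at $(Y,0)$ and $0$ at $(Y,j)$ for $j\ne0$, and let $\mathcal M=\mathsf{add}\{\mathcal A_0(-,X)\mid X\in\mathcal A\}\subset\mathsf{Mod}\,\mathsf R\mathcal A$. For an $\mathsf R\mathcal A$-module $M$ let $\rho(M)$ be the $\mathcal A$-module $X\mapsto\bigoplus_{i\in\mathbb Z}M(X,i)$, and let $\mathsf{GP}(\mathsf R\mathcal A,\mathcal A)$ be the full subcategory of those $M\in\mathsf{GP}(\mathsf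 R\mathcal A)$ for which $\rho(M)$ has finite projective dimension over $\mathcal A$. For a Frobenius subcategory $\mathcal F$ of an abelian category, $\underline{\mathcal F}$ is its stable category (morphisms modulo those factoring through relative-projective objects) with Happel's triangulated structure. A full subcategory $\mathcal M$ of a triangulated category $\mathcal T$ is *tilting* if $\mathcal T(\mathcal M,\mathcal M[i])=0$ for all $i\neq0$ and the smallest thick subcategory of $\mathcal T$ containing $\mathcal M$ is $\mathcal T$. **Theorem.** Assume that $\mathcal A$ and $\mathcal A^{\rm op}$ satisfy (IFP). (a) If $\mathcal A$ and $\mathcal A^{\rm op}$ satisfy (G), then $\mathcal M\subset\mathsf{GP}(\mathsf R\mathcal A,\mathcal A)$, the category $\mathsf{GP}(\mathsf R\mathcal A,\mathcal A)$ is Frobenius, and $\mathcal M$ gives a tilting subcategory of $\underline{\mathsf{GP}}(\mathsf R\mathcal A,\mathcal A)$. (b) If every object of $\mathsf{mod}\,\mathcal A$ and of $\mathsf{mod}\,\mathcal A^{\rm op}$ has finite projective dimension, then $\mathcal M\subset\mathsf{GP}(\mathsf R\mathcal A)$, the category $\mathsf{GP}(\mathsf R\mathcal A)$ is Frobenius,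 and $\mathcal M$ gives a tilting subcategory of $\underline{\mathsf{GP}}(\mathsf R\mathcal A)$. -/

import Mathlib

open CategoryTheory Category Limits Opposite

universe v u w

noncomputable section

/-! ### Generalities on abelian categories -/

namespace FrobStable

section Abelian

variable {C : Type u} [Category.{v} C] [Abelian C]

/-- `X ⟶ Y ⟶ Z` is exact at `Y`. -/
def IsExactAt {X Y Z : C} (f : X ⟶ Y) (g : Y ⟶ Z) : Prop :=
  ∃ w : f ≫ g = 0, (ShortComplex.mk f g w).Exact

/-- `0 ⟶ X ⟶ Y ⟶ Z ⟶ 0` is exact. -/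
def IsSES {X Y Z : C} (f : X ⟶ Y) (g : Y ⟶ Z) : Prop :=
  ∃ w : f ≫ g = 0, (ShortComplex.mk f g w).ShortExact

/-- `0 ⟶ X ⟶ Y ⟶ Z ⟶ 0` is an exact sequence in the full subcategory `F`: it is exact in the
ambient abelian category and its three terms are in `F`. -/
structure IsSESIn (F : ObjectProperty C) {X Y Z : C} (f : X ⟶ Y) (g : Y ⟶ Z) : Prop where
  ses : IsSES f g
  left : F X
  middle : F Y
  right : F Z

attribute [local instance] Abelian.hasFiniteBiproducts

/-- `add S`: direct summands of finite direct sums of objects in `S`. -/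
def addClosure (S : ObjectProperty C) : ObjectProperty C := fun X =>
  ∃ (n : ℕ) (Y : Fin n → C), (∀ i, S (Y i)) ∧ Nonempty (Retract X (⨁ Y))

/-- Relative-projective objects of `F`: every exact sequence in `F` ending in `Z` splits. -/
def IsRelProjective (F : ObjectProperty C) : ObjectProperty C := fun Z =>
  F Z ∧ ∀ ⦃X Y : C⦄ (f : X ⟶ Y) (g : Y ⟶ Z), IsSESIn F f g → ∃ s : Z ⟶ Y, s ≫ g = 𝟙 Z

/-- Relative-injective objects of `F`: every exact sequence in `F` starting in `X` splits. -/
def IsRelInjective (F : ObjectProperty C) : ObjectProperty C := fun X =>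
  F X ∧ ∀ ⦃Y Z : C⦄ (f : X ⟶ Y) (g : Y ⟶ Z), IsSESIn F f g → ∃ r : Y ⟶ X, f ≫ r = 𝟙 X

/-- `F` is a Frobenius subcategory of the abelian category `C`: it contains a zero object, it is
closed under extensions, it has enough projectives and enough injectives, and relative-projective
and relative-injective objects coincide. -/
structure IsFrobenius (F : ObjectProperty C) : Prop where
  containsZero : F.ContainsZero
  ext : F.IsClosedUnderExtensions
  enoughProjectives : ∀ X, F X →
    ∃ (K P : C) (i : K ⟶ P) (p : P ⟶ X), IsSESIn F i p ∧ IsRelProjective F P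
  enoughInjectives : ∀ X, F X →
    ∃ (I L : C) (i : X ⟶ I) (p : I ⟶ L), IsSESIn F i p ∧ IsRelInjective F I
  relProjective_eq_relInjective : IsRelProjective F = IsRelInjective F

/-- Two morphisms of `F` are identified in the stable category when their difference factors
through a relative-projective object. -/
def stableRel (F : ObjectProperty C) : HomRel F.FullSubcategory := fun X Y f g =>
  ∃ (P : C) (_ : IsRelProjective F P) (a : X.obj ⟶ P) (b : P ⟶ Y.obj), f.hom - g.hom = a ≫ b

/-- The stable category `F / [P]` of `F`, where `P` is the class of relative-projectives. -/
abbrev Stable (F : ObjectProperty C) := CategoryTheory.Quotient (stableRel F)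

/-- The object of the stable category given by an object of `F`. -/
abbrev Stable.of {F : ObjectProperty C} {X : C} (hX : F X) : Stable F := ⟨⟨X, hX⟩⟩

/-- The morphism of the stable category given by a morphism of `C` between objects of `F`. -/
abbrev Stable.ofHom {F : ObjectProperty C} {X Y : C} (hX : F X) (hY : F Y) (f : X ⟶ Y) :
    Stable.of hX ⟶ Stable.of hY :=
  (CategoryTheory.Quotient.functor (stableRel F)).map (X := ⟨X, hX⟩) (Y := ⟨Y, hY⟩) (ObjectProperty.homMk f)

/-- In an extension closed subcategory, morphisms to a relative-injective object extend along
the inflations of `F`. -/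
theorem IsRelInjective.exists_extension {F : ObjectProperty C} (hF : F.IsClosedUnderExtensions)
    {I : C} (hI : IsRelInjective F I) {X Y Z : C} {i : X ⟶ Y} {p : Y ⟶ Z} (h : IsSESIn F i p)
    (f : X ⟶ I) : ∃ g : Y ⟶ I, i ≫ g = f := by
  obtain ⟨w, hw⟩ := h.ses
  have : Mono i := hw.mono_f
  have : Epi p := hw.epi_g
  let q : pushout i f ⟶ Z := pushout.desc p 0 (by simp [w])
  have hq1 : pushout.inl i f ≫ q = p := pushout.inl_desc _ _ _
  have hq2 : pushout.inr i f ≫ q = 0 := pushout.inr_desc _ _ _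
  have : Epi q := by
    have : Epi (pushout.inl i f ≫ q) := by rw [hq1]; infer_instance
    exact epi_of_epi (pushout.inl i f) q
  have hc : IsColimit (CokernelCofork.ofπ q hq2) :=
    CokernelCofork.IsColimit.ofπ' q hq2 (fun {A} k hk => by
      have h0 : i ≫ pushout.inl i f ≫ k = 0 := by
        rw [pushout.condition_assoc, hk, comp_zero]
      refine ⟨hw.exact.desc (pushout.inl i f ≫ k) h0, ?_⟩
      apply pushout.hom_ext
      · rw [← assoc, hq1]
        exact hw.exact.g_desc _ h0
      · rw [← assoc, hq2, zero_comp, hk])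
  have hs : (ShortComplex.mk (pushout.inr i f) q hq2).ShortExact :=
    { exact := ShortComplex.exact_of_g_is_cokernel _ hc
      mono_f := inferInstanceAs (Mono (pushout.inr i f))
      epi_g := inferInstanceAs (Epi q) }
  obtain ⟨r, hr⟩ := hI.2 (pushout.inr i f) q
    ⟨⟨hq2, hs⟩, hI.1, hF.prop_X₂_of_shortExact hs hI.1 h.right, h.right⟩
  exact ⟨pushout.inl i f ≫ r, by rw [pushout.condition_assoc, hr, comp_id]⟩

/-- An exact sequence `0 ⟶ X ⟶ I ⟶ L ⟶ 0` in `F` with `I` relative-injective. -/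
structure InjSES (F : ObjectProperty C) (X : C) where
  I : C
  L : C
  i : X ⟶ I
  p : I ⟶ L
  ses : IsSESIn F i p
  inj : IsRelInjective F I

/-- An exact sequence `0 ⟶ K ⟶ P ⟶ X ⟶ 0` in `F` with `P` relative-projective. -/
structure ProjSES (F : ObjectProperty C) (X : C) where
  K : C
  P : C
  i : K ⟶ P
  p : P ⟶ X
  ses : IsSESIn F i p
  proj : IsRelProjective F P

namespace IsFrobenius

variable {F : ObjectProperty C} (hF : IsFrobenius F)

/-- A choice of an exact sequence `0 ⟶ X ⟶ I(X) ⟶ ΣX ⟶ 0` for every object `X` of `F`. -/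
def injSES (X : F.FullSubcategory) : InjSES F X.obj :=
  Classical.choice (by
    obtain ⟨I, L, i, p, h, hI⟩ := hF.enoughInjectives X.obj X.property
    exact ⟨⟨I, L, i, p, h, hI⟩⟩)

/-- A choice of an exact sequence `0 ⟶ ΩX ⟶ P(X) ⟶ X ⟶ 0` for every object `X` of `F`. -/
def projSES (X : F.FullSubcategory) : ProjSES F X.obj :=
  Classical.choice (by
    obtain ⟨K, P, i, p, h, hP⟩ := hF.enoughProjectives X.obj X.property
    exact ⟨⟨K, P, i, p, h, hP⟩⟩)

/-- The cosyzygy `ΣX`, as an object of `F`. -/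
abbrev suspObj (X : F.FullSubcategory) : F.FullSubcategory :=
  ⟨(hF.injSES X).L, (hF.injSES X).ses.right⟩

/-- The syzygy `ΩX`, as an object of `F`. -/
abbrev loopObj (X : F.FullSubcategory) : F.FullSubcategory :=
  ⟨(hF.projSES X).K, (hF.projSES X).ses.left⟩

/-- `h : ΣX ⟶ ΣY` is induced by `f : X ⟶ Y`: there is a commutative diagram with rows
`0 ⟶ X ⟶ I(X) ⟶ ΣX ⟶ 0` and `0 ⟶ Y ⟶ I(Y) ⟶ ΣY ⟶ 0` and with columns `f`, some `g`, and `h`. -/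
def IsInduced {X Y : F.FullSubcategory} (f : X ⟶ Y) (h : hF.suspObj X ⟶ hF.suspObj Y) : Prop :=
  ∃ g : (hF.injSES X).I ⟶ (hF.injSES Y).I,
    (hF.injSES X).i ≫ g = f.hom ≫ (hF.injSES Y).i ∧
    (hF.injSES X).p ≫ h.hom = g ≫ (hF.injSES Y).p

theorem exists_isInduced {X Y : F.FullSubcategory} (f : X ⟶ Y) :
    ∃ h : hF.suspObj X ⟶ hF.suspObj Y, hF.IsInduced f h := by
  obtain ⟨g, hg⟩ := (hF.injSES Y).inj.exists_extension hF.ext (hF.injSES X).ses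
    (f.hom ≫ (hF.injSES Y).i)
  obtain ⟨w, hw⟩ := (hF.injSES X).ses.ses
  obtain ⟨w', -⟩ := (hF.injSES Y).ses.ses
  have : Epi (hF.injSES X).p := hw.epi_g
  have h0 : (hF.injSES X).i ≫ g ≫ (hF.injSES Y).p = 0 := by
    rw [← assoc, hg, assoc, w', comp_zero]
  exact ⟨ObjectProperty.homMk (hw.exact.desc (g ≫ (hF.injSES Y).p) h0), g, hg,
    hw.exact.g_desc _ h0⟩

theorem IsInduced.stableRel {X Y : F.FullSubcategory} {f f' : X ⟶ Y}
    {h h' : hF.suspObj X ⟶ hF.suspObj Y} (H : hF.IsInduced f h) (H' : hF.IsInduced f' h')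
    (hf : stableRel F f f') : stableRel F h h' := by
  obtain ⟨g, hg, hgh⟩ := H
  obtain ⟨g', hg', hgh'⟩ := H'
  obtain ⟨P, hP, a, b, hab⟩ := hf
  have hP' : IsRelInjective F P := by rw [← hF.relProjective_eq_relInjective]; exact hP
  obtain ⟨a', ha'⟩ := hP'.exists_extension hF.ext (hF.injSES X).ses a
  obtain ⟨w, hw⟩ := (hF.injSES X).ses.ses
  obtain ⟨w', -⟩ := (hF.injSES Y).ses.ses
  have : Epi (hF.injSES X).p := hw.epi_g
  have h0 : (hF.injSES X).i ≫ (g - g' - a' ≫ b ≫ (hF.injSES Y).i) = 0 := by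
    rw [Preadditive.comp_sub, Preadditive.comp_sub, hg, hg', ← Preadditive.sub_comp, hab,
      ← assoc, ha', assoc, sub_self]
  have hs := hw.exact.g_desc (g - g' - a' ≫ b ≫ (hF.injSES Y).i) h0
  refine ⟨(hF.injSES Y).I, ?_, hw.exact.desc _ h0, (hF.injSES Y).p, ?_⟩
  · rw [hF.relProjective_eq_relInjective]; exact (hF.injSES Y).inj
  · rw [← cancel_epi (hF.injSES X).p, Preadditive.comp_sub, hgh, hgh', ← assoc]
    erw [hs]
    simp [Preadditive.sub_comp, w']

theorem stableRel_refl (hF : IsFrobenius F) {X Y : F.FullSubcategory} (f : X ⟶ Y) : stableRel F f f := by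
  refine ⟨(hF.injSES X).I, ?_, 0, 0, by simp⟩
  rw [hF.relProjective_eq_relInjective]; exact (hF.injSES X).inj

/-- The suspension functor `Σ` of the stable category: `0 ⟶ X ⟶ I(X) ⟶ ΣX ⟶ 0` is exact with
`I(X)` relative-injective, and `Σ` of a morphism is the induced morphism on cokernels. -/
def susp : Stable F ⥤ Stable F :=
  CategoryTheory.Quotient.lift _
    { obj := fun X => ⟨hF.suspObj X⟩
      map := fun f =>
        (CategoryTheory.Quotient.functor (FrobStable.stableRel F)).map (hF.exists_isInduced f).choose
      map_id := fun X => by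
        refine (CategoryTheory.Quotient.sound _ (IsInduced.stableRel hF
          (hF.exists_isInduced (𝟙 X)).choose_spec (h' := 𝟙 _)
          ⟨𝟙 _, ?_, ?_⟩ (hF.stableRel_refl _))).trans
          (CategoryTheory.Functor.map_id _ _) <;> simp
      map_comp := fun {X Y Z} f g => by
        rw [← Functor.map_comp]
        obtain ⟨a, ha, ha'⟩ := (hF.exists_isInduced f).choose_spec
        obtain ⟨b, hb, hb'⟩ := (hF.exists_isInduced g).choose_spec
        refine CategoryTheory.Quotient.sound _ (IsInduced.stableRel hF
          (hF.exists_isInduced (f ≫ g)).choose_spec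
          ⟨a ≫ b, ?_, ?_⟩ (hF.stableRel_refl _))
        · rw [← assoc, ha, assoc, hb]; simp
        · simp only [ObjectProperty.FullSubcategory.comp_hom]
          rw [← assoc, ha', assoc, hb', assoc] }
    (fun X Y f f' hf => CategoryTheory.Quotient.sound _ (IsInduced.stableRel hF
      (hF.exists_isInduced f).choose_spec (hF.exists_isInduced f').choose_spec hf))

/-- The object `X[i]` of the stable category: `X[n] = Σⁿ X` and `X[-n] = Ωⁿ X` for `n ≥ 0`, where
`Ω` takes kernels of relative-projective presentations (`Ω` is quasi-inverse to `Σ`). -/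
def shift (i : ℤ) (X : Stable F) : Stable F :=
  match i with
  | Int.ofNat n => (fun Y : Stable F => hF.susp.obj Y)^[n] X
  | Int.negSucc n => (fun Y : Stable F => (⟨hF.loopObj Y.as⟩ : Stable F))^[n + 1] X

/-- `w : Z ⟶ ΣX` is the connecting morphism of an exact sequence `0 ⟶ X ⟶ Y ⟶ Z ⟶ 0` in `F` with
maps `u` and `v`: the latter maps to `0 ⟶ X ⟶ I(X) ⟶ ΣX ⟶ 0` by `𝟙 X`, some `y`, and `w`. -/
structure IsConnecting {X Y Z : F.FullSubcategory} (u : X ⟶ Y) (v : Y ⟶ Z)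
    (w : Z ⟶ hF.suspObj X) : Prop where
  ses : IsSESIn F u.hom v.hom
  comm : ∃ y : Y.obj ⟶ (hF.injSES X).I,
    u.hom ≫ y = (hF.injSES X).i ∧ v.hom ≫ w.hom = y ≫ (hF.injSES X).p

/-- The distinguished triangles of the stable category: triangles isomorphic to
`X ⟶ Y ⟶ Z ⟶ ΣX` with maps `u`, `v`, `-w` for some exact sequence `0 ⟶ X ⟶ Y ⟶ Z ⟶ 0` in `F` with
connecting morphism `w`. The sign makes them the triangles of mapping cones
`X ⟶ Y ⟶ Y ⊔_X I(X) ⟶ ΣX`. -/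
def IsDistinguished {X Y Z : Stable F} (a : X ⟶ Y) (b : Y ⟶ Z) (c : Z ⟶ hF.susp.obj X) : Prop :=
  ∃ (X' Y' Z' : F.FullSubcategory) (u : X' ⟶ Y') (v : Y' ⟶ Z') (w : Z' ⟶ hF.suspObj X')
    (_ : hF.IsConnecting u v w)
    (e₁ : X ≅ (CategoryTheory.Quotient.functor (stableRel F)).obj X')
    (e₂ : Y ≅ (CategoryTheory.Quotient.functor (stableRel F)).obj Y')
    (e₃ : Z ≅ (CategoryTheory.Quotient.functor (stableRel F)).obj Z'),
    a ≫ e₂.hom = e₁.hom ≫ (CategoryTheory.Quotient.functor (stableRel F)).map u ∧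
    b ≫ e₃.hom = e₂.hom ≫ (CategoryTheory.Quotient.functor (stableRel F)).map v ∧
    c ≫ hF.susp.map e₁.hom = e₃.hom ≫ (CategoryTheory.Quotient.functor (stableRel F)).map (-w)

/-- Thick subcategories of the stable category: triangulated subcategories (nonempty, closed under
isomorphisms and under `[1]`, `[-1]`, and having the two-out-of-three property on distinguished
triangles) that are closed under direct summands. -/
structure IsThick (U : ObjectProperty (Stable F)) : Prop where
  zero : ∀ X : Stable F, IsZero X → U X
  shift_mem : ∀ (i : ℤ) (X : Stable F), U X → U (hF.shift i X)
  obj₁ : ∀ {X Y Z : Stable F} (a : X ⟶ Y) (b : Y ⟶ Z) (c : Z ⟶ hF.susp.obj X),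
    hF.IsDistinguished a b c → U Y → U Z → U X
  obj₂ : ∀ {X Y Z : Stable F} (a : X ⟶ Y) (b : Y ⟶ Z) (c : Z ⟶ hF.susp.obj X),
    hF.IsDistinguished a b c → U X → U Z → U Y
  obj₃ : ∀ {X Y Z : Stable F} (a : X ⟶ Y) (b : Y ⟶ Z) (c : Z ⟶ hF.susp.obj X),
    hF.IsDistinguished a b c → U X → U Y → U Z
  retract : U.IsStableUnderRetracts

/-- `thick M`: the smallest thick subcategory containing `M`. -/
def thick (M : ObjectProperty (Stable F)) : ObjectProperty (Stable F) := fun X =>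
  ∀ U : ObjectProperty (Stable F), hF.IsThick U → M ≤ U → U X

/-- `M` is a tilting subcategory of the stable category `T` of `F`: `T(M, M[i]) = 0` for `i ≠ 0`
and `thick M = T`. -/
structure IsTilting (M : ObjectProperty (Stable F)) : Prop where
  hom_shift_eq_zero : ∀ X Y : Stable F, M X → M Y → ∀ i : ℤ, i ≠ 0 →
    Subsingleton (X ⟶ hF.shift i Y)
  thick_eq_top : hF.thick M = ⊤

end IsFrobenius

end Abelian

end FrobStable
/-! ### Modules over linear categories -/

namespace LinMod

/-- The `k`-linear structure on the opposite category. -/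
instance oppositeLinear (k : Type w) [Field k] (A : Type u) [Category.{v} A] [Preadditive A]
    [Linear k A] : Linear k Aᵒᵖ where
  homModule X Y := Equiv.module k (opEquiv X Y)
  smul_comp _ _ _ r f g := Quiver.Hom.unop_inj (Linear.comp_smul _ _ _ g.unop r f.unop)
  comp_smul _ _ _ f r g := Quiver.Hom.unop_inj (Linear.smul_comp _ _ _ r g.unop f.unop)

theorem op_op_smul {k : Type w} [Field k] {A : Type u} [Category.{v} A] [Preadditive A]
    [Linear k A] {X Y : A} (r : k) (f : X ⟶ Y) : (r • f).op = r • f.op := rfl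

theorem op_unop_smul {k : Type w} [Field k] {A : Type u} [Category.{v} A] [Preadditive A]
    [Linear k A] {X Y : Aᵒᵖ} (r : k) (f : X ⟶ Y) : (r • f).unop = r • f.unop := rfl

section

variable (k : Type v) [Field k] (A : Type u) [Category.{v} A] [Preadditive A] [Linear k A]

/-- Contravariant `k`-linear functors from `A` to `k`-vector spaces. -/
def isLinear : ObjectProperty (Aᵒᵖ ⥤ ModuleCat.{v} k) := fun M => M.Additive ∧ M.Linear k

/-- `Mod A`: the category of `A`-modules, that is, of contravariant `k`-linear functors from `A` to
`k`-vector spaces. -/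
abbrev Mod := (isLinear k A).FullSubcategory

instance : (isLinear k A).IsClosedUnderSubobjects where
  prop_of_mono {M N} i _ hN := by
    obtain ⟨_, _⟩ := hN
    have (X : Aᵒᵖ) : Mono (i.app X) := inferInstance
    exact ⟨⟨by intro X Y f g; rw [← cancel_mono (i.app Y)]; simp⟩,
      ⟨by intro X Y f r; rw [← cancel_mono (i.app Y)]; simp⟩⟩

instance : (isLinear k A).IsClosedUnderQuotients where
  prop_of_epi {M N} p _ hM := by
    obtain ⟨_, _⟩ := hM
    have (X : Aᵒᵖ) : Epi (p.app X) := inferInstance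
    exact ⟨⟨by intro X Y f g; rw [← cancel_epi (p.app X)]; simp [← NatTrans.naturality]⟩,
      ⟨by intro X Y f r; rw [← cancel_epi (p.app X)]; simp [← NatTrans.naturality]⟩⟩

instance : (isLinear k A).ContainsZero where
  exists_zero := by
    have h : IsZero (ModuleCat.of k PUnit.{v + 1}) := ModuleCat.isZero_of_subsingleton _
    exact ⟨(Functor.const _).obj (ModuleCat.of k PUnit), Functor.isZero _ fun _ => h,
      ⟨⟨h.eq_of_tgt _ _⟩, ⟨fun _ _ => h.eq_of_tgt _ _⟩⟩⟩

instance : (isLinear k A).IsClosedUnderFiniteProducts where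
  isClosedUnderLimitsOfShape J _ :=
    { limitsOfShape_le := by
        rintro M ⟨p⟩
        have h (Y : Aᵒᵖ) := isLimitOfPreserves ((evaluation _ _).obj Y) p.isLimit
        have hp (j : Discrete J) := p.prop_diag_obj j
        refine ⟨⟨fun {X Y f g} => (h Y).hom_ext fun j => ?_⟩,
          ⟨fun {X Y} f r => (h Y).hom_ext fun j => ?_⟩⟩
        · obtain ⟨_, _⟩ := hp j
          have e (f : X ⟶ Y) := (p.π.app j).naturality f
          dsimp at e ⊢
          rw [Preadditive.add_comp, e, e, e, Functor.map_add, Preadditive.comp_add]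
        · obtain ⟨_, _⟩ := hp j
          have e (f : X ⟶ Y) := (p.π.app j).naturality f
          dsimp at e ⊢
          rw [Linear.smul_comp, e, e, Functor.map_smul, Linear.comp_smul] }

/-- `Mod A` is abelian; its kernels and cokernels are computed objectwise. -/
instance : Abelian (Mod k A) := inferInstance

attribute [local instance] Abelian.hasFiniteBiproducts

variable {A} in
/-- The representable module `A(-, X)`. -/
def representable (X : A) : Mod k A :=
  ⟨(linearYoneda k A).obj X, inferInstance, ⟨fun f r => by
    ext x; exact Linear.smul_comp _ _ _ r f.unop x⟩⟩

variable {A} in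
/-- The module `D A(X, -)`, where `D = Hom_k(-, k)`. -/
def dualRepr (X : A) : Mod k A :=
  ⟨{ obj := fun Y => ModuleCat.of k (Module.Dual k (X ⟶ Y.unop))
     map := fun f => ModuleCat.ofHom (Linear.rightComp k X f.unop).dualMap
     map_id := fun Y => by ext; simp
     map_comp := fun f g => by ext; simp },
   ⟨⟨by intros; ext; simp⟩, ⟨fun f r => by ext φ x; simp [op_unop_smul]⟩⟩⟩

variable {k A}

/-- Finitely generated modules: quotients of finite direct sums of representable modules. If `A` has
finite direct sums, then these are the quotients of representable modules. -/
def IsFG (M : Mod k A) : Prop :=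
  ∃ (n : ℕ) (X : Fin n → A) (p : (⨁ fun i => representable k (X i)) ⟶ M), Epi p

variable (k A) in
/-- `proj A`: the finitely generated projective modules. -/
def proj : ObjectProperty (Mod k A) := fun P => IsFG P ∧ Projective P

variable (k A) in
/-- `mod A`: the modules `M` that have a resolution `⋯ ⟶ P₁ ⟶ P₀ ⟶ M ⟶ 0` by finitely generated
projective modules. -/
def fpInf : ObjectProperty (Mod k A) := fun M =>
  ∃ (P : ℕ → Mod k A) (d : ∀ n, P (n + 1) ⟶ P n) (ε : P 0 ⟶ M),
    (∀ n, proj k A (P n)) ∧ Epi ε ∧ FrobStable.IsExactAt (d 0) ε ∧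
      ∀ n, FrobStable.IsExactAt (d (n + 1)) (d n)

/-- `M` has finite projective dimension over `A`. -/
def HasFinitePD (M : Mod k A) : Prop := ∃ n : ℕ, HasProjectiveDimensionLE M n

/-- A totally acyclic complex of finitely generated projective modules `⋯ ⟶ Pᵢ ⟶ Pᵢ₊₁ ⟶ ⋯`: it is
acyclic and the complex `⋯ ⟶ (Pᵢ₊₁)^* ⟶ (Pᵢ)^* ⟶ ⋯` of modules over the opposite category is
acyclic, where `M^*(X) = Hom(M, A(-, X))`. The latter is expressed at each object `X`. -/
structure IsTotallyAcyclic (P : CochainComplex (Mod k A) ℤ) : Prop where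
  proj : ∀ i, proj k A (P.X i)
  acyclic : P.Acyclic
  dual_acyclic : ∀ (X : A) (i : ℤ) (φ : P.X i ⟶ representable k X), P.d (i - 1) i ≫ φ = 0 →
    ∃ ψ : P.X (i + 1) ⟶ representable k X, φ = P.d i (i + 1) ≫ ψ

variable (k A) in
/-- `GP(A)`: Gorenstein-projective modules, the images of `d⁰` in totally acyclic complexes. -/
def GP : ObjectProperty (Mod k A) := fun M =>
  ∃ P : CochainComplex (Mod k A) ℤ, IsTotallyAcyclic P ∧ Nonempty (image (P.d 0 1) ≅ M)

variable (k A) in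
/-- Condition (IFP): `D A(X, -)` is in `mod A` for all `X`. -/
def IFP : Prop := ∀ X : A, fpInf k A (dualRepr k X)

variable (k A) in
/-- Condition (G): `D A(X, -)` has finite projective dimension over `A` for all `X`. -/
def CondG : Prop := ∀ X : A, HasFinitePD (dualRepr k X)

end

end LinMod

/-! ### The repetitive category -/

/-- Objects `(X, i)` with `X` in `A` and `i` an integer. -/
structure RepCat (k : Type v) (A : Type u) where
  obj : A
  deg : ℤ

namespace RepCat

open LinMod

section

variable {k : Type v} [Field k] {A : Type u} [Category.{v} A] [Preadditive A] [Linear k A]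

/-- Morphisms `(X, i) ⟶ (Y, j)`: pairs of a morphism `X ⟶ Y`, required to be zero unless `i = j`,
and a linear form on `A(Y, X)`, required to be zero unless `j = i + 1`. So this is `A(X, Y)` for
`i = j`, it is `D A(Y, X)` for `j = i + 1`, and it is zero otherwise. -/
def homSub (X Y : RepCat k A) :
    Submodule k ((X.obj ⟶ Y.obj) × Module.Dual k (Y.obj ⟶ X.obj)) where
  carrier := {p | (X.deg ≠ Y.deg → p.1 = 0) ∧ (Y.deg ≠ X.deg + 1 → p.2 = 0)}
  add_mem' := fun {p q} hp hq =>
    ⟨fun h => by simp [hp.1 h, hq.1 h], fun h => by simp [hp.2 h, hq.2 h]⟩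
  zero_mem' := ⟨fun _ => rfl, fun _ => rfl⟩
  smul_mem' := fun r p hp => ⟨fun h => by simp [hp.1 h], fun h => by simp [hp.2 h]⟩

/-- The category of the pairs `(X, i)`. The composite of `(f, φ)` and `(g, ψ)` is
`(f ≫ g, h ↦ ψ (h ≫ f) + φ (g ≫ h))`. -/
instance : Category (RepCat k A) where
  Hom X Y := homSub X Y
  id X := ⟨(𝟙 X.obj, 0), fun h => (h rfl).elim, fun _ => rfl⟩
  comp {X Y Z} a b :=
    ⟨(a.1.1 ≫ b.1.1,
      b.1.2 ∘ₗ Linear.rightComp k Z.obj a.1.1 + a.1.2 ∘ₗ Linear.leftComp k X.obj b.1.1), by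
      obtain ⟨⟨f, φ⟩, ha⟩ := a
      obtain ⟨⟨g, ψ⟩, hb⟩ := b
      dsimp only at *
      constructor
      · intro h
        by_cases h' : X.deg = Y.deg
        · rw [show g = 0 from hb.1 (by omega), comp_zero]
        · rw [show f = 0 from ha.1 h', zero_comp]
      · intro h
        have h₁ : ψ ∘ₗ Linear.rightComp k Z.obj f = 0 := by
          by_cases h' : X.deg = Y.deg
          · rw [show ψ = 0 from hb.2 (by omega), LinearMap.zero_comp]
          · rw [show f = 0 from ha.1 h']; ext; simp
        have h₂ : φ ∘ₗ Linear.leftComp k X.obj g = 0 := by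
          by_cases h' : Y.deg = Z.deg
          · rw [show φ = 0 from ha.2 (by omega), LinearMap.zero_comp]
          · rw [show g = 0 from hb.1 h']; ext; simp
        rw [h₁, h₂, add_zero]⟩
  id_comp a := Subtype.ext (Prod.ext (id_comp _) (by ext; simp))
  comp_id a := Subtype.ext (Prod.ext (comp_id _) (by ext; simp))
  assoc a b c := Subtype.ext (Prod.ext (assoc _ _ _) (by ext; simp [add_assoc]))

@[simp] theorem comp_fst {X Y Z : RepCat k A} (a : X ⟶ Y) (b : Y ⟶ Z) :
    (a ≫ b).1.1 = a.1.1 ≫ b.1.1 := rfl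

@[simp] theorem comp_snd {X Y Z : RepCat k A} (a : X ⟶ Y) (b : Y ⟶ Z) (h : Z.obj ⟶ X.obj) :
    (a ≫ b).1.2 h = b.1.2 (h ≫ a.1.1) + a.1.2 (b.1.1 ≫ h) := rfl

theorem hom_ext {X Y : RepCat k A} {a b : X ⟶ Y} (h₁ : a.1.1 = b.1.1)
    (h₂ : ∀ h : Y.obj ⟶ X.obj, a.1.2 h = b.1.2 h) : a = b :=
  Subtype.ext (Prod.ext h₁ (LinearMap.ext h₂))

instance (X Y : RepCat k A) : AddCommGroup (X ⟶ Y) := inferInstanceAs (AddCommGroup (homSub X Y))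

instance (X Y : RepCat k A) : Module k (X ⟶ Y) := inferInstanceAs (Module k (homSub X Y))

@[simp] theorem add_fst {X Y : RepCat k A} (a b : X ⟶ Y) : (a + b).1.1 = a.1.1 + b.1.1 := rfl

@[simp] theorem add_snd {X Y : RepCat k A} (a b : X ⟶ Y) : (a + b).1.2 = a.1.2 + b.1.2 := rfl

@[simp] theorem smul_fst {X Y : RepCat k A} (r : k) (a : X ⟶ Y) : (r • a).1.1 = r • a.1.1 := rfl

@[simp] theorem smul_snd {X Y : RepCat k A} (r : k) (a : X ⟶ Y) : (r • a).1.2 = r • a.1.2 := rfl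

instance : Preadditive (RepCat k A) where
  add_comp X Y Z a a' b := hom_ext (by simp) fun h => by simp; abel
  comp_add X Y Z a b b' := hom_ext (by simp) fun h => by simp; abel

instance : Linear k (RepCat k A) where
  smul_comp X Y Z r a b := hom_ext (by simp) fun h => by simp [mul_add]
  comp_smul X Y Z a r b := hom_ext (by simp) fun h => by simp [mul_add]

/-- `Hom((X, i), (Y, i)) = A(X, Y)`. -/
def homSame (X Y : A) (i : ℤ) : ((⟨X, i⟩ : RepCat k A) ⟶ ⟨Y, i⟩) ≃ₗ[k] (X ⟶ Y) where
  toFun a := a.1.1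
  map_add' _ _ := rfl
  map_smul' _ _ := rfl
  invFun f := ⟨(f, 0), fun h => (h rfl).elim, fun _ => rfl⟩
  left_inv a := hom_ext rfl fun h => by
    simp [show a.1.2 = 0 from a.2.2 (by simp)]
  right_inv _ := rfl

/-- `Hom((X, i), (Y, i + 1)) = D A(Y, X)`. -/
def homSucc (X Y : A) (i : ℤ) :
    ((⟨X, i⟩ : RepCat k A) ⟶ ⟨Y, i + 1⟩) ≃ₗ[k] Module.Dual k (Y ⟶ X) where
  toFun a := a.1.2
  map_add' _ _ := rfl
  map_smul' _ _ := rfl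
  invFun φ := ⟨(0, φ), fun _ => rfl, fun h => (h rfl).elim⟩
  left_inv a := hom_ext (a.2.1 (by simp)).symm fun h => rfl
  right_inv _ := rfl

/-- `Hom((X, i), (Y, j)) = 0` unless `j = i` or `j = i + 1`. -/
theorem hom_eq_zero {X Y : RepCat k A} (h₀ : Y.deg ≠ X.deg) (h₁ : Y.deg ≠ X.deg + 1) (a : X ⟶ Y) :
    a = 0 :=
  Subtype.ext (Prod.ext (a.2.1 h₀.symm) (a.2.2 h₁))

variable (k) in
/-- The inclusion `A ⥤ A_i`, `X ↦ (X, i)`. -/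
def incl (i : ℤ) : A ⥤ RepCat k A where
  obj X := ⟨X, i⟩
  map f := (homSame _ _ i).symm f
  map_id _ := rfl
  map_comp _ _ := hom_ext rfl fun _ => (add_zero (0 : k)).symm

instance (i : ℤ) : (incl (A := A) k i).Additive where
  map_add := hom_ext rfl fun _ => (add_zero (0 : k)).symm

instance (i : ℤ) : (incl (A := A) k i).Linear k where
  map_smul _ r := hom_ext rfl fun _ => (mul_zero r).symm

/-- The forgetful functor `ρ` on objects: `ρ(M)(X) = ⨁ i, M(X, i)`. -/
def rho (M : Mod k (RepCat k A)) : Mod k A :=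
  ⟨{ obj := fun X => ModuleCat.of k (DirectSum ℤ fun i => M.obj.obj (op ((incl k i).obj X.unop)))
     map := fun f => ModuleCat.ofHom
      (DirectSum.lmap fun i => (M.obj.map ((incl k i).map f.unop).op).hom)
     map_id := fun X => by ext; simp
     map_comp := fun f g => by ext; simp },
   ⟨⟨fun {X Y f g} => by
      have := M.property.1
      ext x i
      simp [op_add]⟩,
    ⟨fun f r => by
      have := M.property.2
      ext x i
      simp [op_unop_smul, op_op_smul]⟩⟩⟩

/-- The space `A(Y, X)` for `j = i` and zero otherwise, for an object `(Y, j)`. -/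
def layerSub (i : ℤ) (X : A) (Y : RepCat k A) : Submodule k (Y.obj ⟶ X) where
  carrier := {f | Y.deg ≠ i → f = 0}
  add_mem' := fun hf hg h => by simp [hf h, hg h]
  zero_mem' := fun _ => rfl
  smul_mem' := fun r f hf h => by simp [hf h]

theorem comp_mem_layerSub {i : ℤ} {X : A} {Y Z : RepCat k A} (a : Z ⟶ Y) (f : Y.obj ⟶ X)
    (hf : f ∈ layerSub i X Y) : a.1.1 ≫ f ∈ layerSub i X Z := fun h => by
  by_cases h' : Y.deg = i
  · rw [show a.1.1 = 0 from a.2.1 (by omega), zero_comp]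
  · rw [show f = 0 from hf h', comp_zero]

variable (k) in
/-- The `A_i`-module `A_i(-, X)`, regarded as a module over the repetitive category: its value at
`(Y, j)` is `A(Y, X)` if `j = i` and zero otherwise, and `A(Y', Y)` acts by composition. -/
def layer (i : ℤ) (X : A) : Mod k (RepCat k A) :=
  ⟨{ obj := fun Y => ModuleCat.of k (layerSub i X Y.unop)
     map := fun a => ModuleCat.ofHom
      ((Linear.leftComp k X a.unop.1.1).restrict (comp_mem_layerSub a.unop))
     map_id := fun Y => by ext f; exact id_comp f.1
     map_comp := fun a b => by
      ext f; exact assoc b.unop.1.1 a.unop.1.1 f.1 },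
   ⟨⟨fun {Y Z a b} => by
      ext f
      exact Preadditive.add_comp _ _ _ a.unop.1.1 b.unop.1.1 f.1⟩,
    ⟨fun a r => by
      ext f
      exact Linear.smul_comp _ _ _ r a.unop.1.1 f.1⟩⟩⟩

variable (k A) in
/-- The subcategory `M = add {A₀(-, X) | X ∈ A}`. -/
def layerZero : ObjectProperty (Mod k (RepCat k A)) :=
  FrobStable.addClosure fun N => ∃ X : A, N = layer k 0 X

variable (k A) in
/-- `GP(RA, A)`: the Gorenstein-projective modules `M` over the repetitive category such that
`ρ(M)` has finite projective dimension over `A`. -/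
def GPFin : ObjectProperty (Mod k (RepCat k A)) := fun M =>
  GP k (RepCat k A) M ∧ HasFinitePD (rho M)

/-- `M ⊆ F`, and `M` gives a tilting subcategory of the stable category of the Frobenius
category `F`. -/
def IsTiltingIn (M F : ObjectProperty (Mod k (RepCat k A))) : Prop :=
  M ≤ F ∧ ∃ hF : FrobStable.IsFrobenius F, hF.IsTilting fun X => M X.as.obj

end

end RepCat
end

/-! Write R for the repetitive category. Hom-finiteness gives R(-, (X, i+1)) ≅ D R((X, i), -), so
finitely generated projective R-modules are injective (`injective_of_proj`). The dual acyclicity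
condition is then automatic, and Gorenstein-projective means: having both a resolution and a
coresolution by finitely generated projectives (`gp_iff`). Such modules, possibly with the
requirement that each homogeneous part has finite projective dimension, form a class closed under
summands and two-out-of-three. If the class contains the projectives, it is Frobenius with these as
its relative-projectives and relative-injectives (`isFrobeniusPair`).

Everything about `layerZero` comes from one sequence (`isSES_representable`): 0 → D A(X,-) in degree
i → R(-, (X, i+1)) → A(-,X) in degree i+1 → 0. With (IFP) it can be continued indefinitely to the
left and, by duality, to the right, so the layers are Gorenstein-projective (`layer_mem_gpRestr`).
It also shows that syzygies of modules in degree 0 can be chosen in negative degrees. Disjoint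
supports then leave no nonzero morphisms between them and `layerZero`, and dimension shifting
(`stZero_iff`) gives the vanishing of all shifted stable Homs.

For generation, (G) for A builds D A(X,-) in degree i from the representables in degree i, and the
sequence passes to degree i+1. (G) for the opposite category moves down in the same way
(`place_representable_mem`). A finitely generated R-module lives in finitely many degrees, and
filtering it by degree reduces it to its homogeneous parts, which are in mod A
(`gpRestr_le_of_isThickClass`).

Both parts of the theorem are cases of `isTiltingIn_gpRestr`: for (a) finite projective dimension of
`rho M` is a degreewise condition, and for (b) this condition always holds. Resolutions are handled
coinductively through `Res`, so that closure properties are proved by exhibiting a class stable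
under taking kernels of covers, without manipulating complexes. -/

noncomputable section

namespace FrobStable

/-! ### Short exact sequences in an abelian category. -/

section Sequences

variable {C : Type u} [Category.{v} C] [Abelian C]

theorem IsSES.w {X Y Z : C} {f : X ⟶ Y} {g : Y ⟶ Z} (h : IsSES f g) : f ≫ g = 0 := h.1

theorem IsSES.mono {X Y Z : C} {f : X ⟶ Y} {g : Y ⟶ Z} (h : IsSES f g) : Mono f := h.2.mono_f

theorem IsSES.epi {X Y Z : C} {f : X ⟶ Y} {g : Y ⟶ Z} (h : IsSES f g) : Epi g := h.2.epi_g

theorem IsSES.exists_lift {X Y Z A : C} {f : X ⟶ Y} {g : Y ⟶ Z} (h : IsSES f g) (k : A ⟶ Y)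
    (hk : k ≫ g = 0) : ∃ l, l ≫ f = k := by
  obtain ⟨w, h⟩ := h
  have := h.mono_f
  exact ⟨h.exact.lift k hk, h.exact.lift_f k hk⟩

theorem IsSES.exists_desc {X Y Z A : C} {f : X ⟶ Y} {g : Y ⟶ Z} (h : IsSES f g) (k : Y ⟶ A)
    (hk : f ≫ k = 0) : ∃ l, g ≫ l = k := by
  obtain ⟨w, h⟩ := h
  have := h.epi_g
  exact ⟨h.exact.desc k hk, h.exact.g_desc k hk⟩

theorem IsSES.of_exists_lift {X Y Z : C} {f : X ⟶ Y} {g : Y ⟶ Z} [hf : Mono f] [hg : Epi g]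
    (w : f ≫ g = 0) (h : ∀ (A : C) (k : A ⟶ Y), k ≫ g = 0 → ∃ l, l ≫ f = k) : IsSES f g :=
  ⟨w, { exact := ShortComplex.exact_of_f_is_kernel _
          (KernelFork.IsLimit.ofι' f w fun {A} k hk => ⟨(h A k hk).choose, (h A k hk).choose_spec⟩)
        mono_f := hf
        epi_g := hg }⟩

theorem IsSES.op {X Y Z : C} {f : X ⟶ Y} {g : Y ⟶ Z} (h : IsSES f g) : IsSES g.op f.op :=
  ⟨by rw [← op_comp, h.w, op_zero], h.2.op⟩

theorem IsSES.unop {X Y Z : Cᵒᵖ} {f : X ⟶ Y} {g : Y ⟶ Z} (h : IsSES f g) :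
    IsSES g.unop f.unop :=
  ⟨by rw [← unop_comp, h.w, unop_zero], h.2.unop⟩

theorem isSES_kernel {Y Z : C} (g : Y ⟶ Z) [Epi g] : IsSES (kernel.ι g) g :=
  IsSES.of_exists_lift (kernel.condition g) fun _ k hk => ⟨kernel.lift g k hk, kernel.lift_ι _ _ _⟩

theorem isSES_cokernel {X Y : C} (f : X ⟶ Y) [Mono f] : IsSES f (cokernel.π f) :=
  IsSES.of_exists_lift (cokernel.condition f) fun _ k hk =>
    ⟨Abelian.monoLift f k hk, Abelian.monoLift_comp f k hk⟩

theorem isSES_biprod (X Y : C) : IsSES (biprod.inl : X ⟶ X ⊞ Y) (biprod.snd : X ⊞ Y ⟶ Y) :=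
  ⟨biprod.inl_snd, (ShortComplex.Splitting.ofHasBinaryBiproduct X Y).shortExact⟩

theorem IsSES.comp_iso_left {X X' Y Z : C} {f : X ⟶ Y} {g : Y ⟶ Z} (h : IsSES f g) (e : X' ≅ X) :
    IsSES (e.hom ≫ f) g := by
  have := h.mono
  have := h.epi
  exact IsSES.of_exists_lift (by rw [assoc, h.w, comp_zero]) fun A k hk => by
    obtain ⟨l, hl⟩ := h.exists_lift k hk
    exact ⟨l ≫ e.inv, by simp [hl]⟩

theorem IsSES.comp_iso_right {X Y Z Z' : C} {f : X ⟶ Y} {g : Y ⟶ Z} (h : IsSES f g) (e : Z ≅ Z') :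
    IsSES f (g ≫ e.hom) := by
  have := h.mono
  have := h.epi
  exact IsSES.of_exists_lift (by rw [← assoc, h.w, zero_comp]) fun A k hk => h.exists_lift k (by
    rw [← cancel_mono e.hom, assoc, hk, zero_comp])

/-- The kernel of a composite of epimorphisms is an extension of their kernels. -/
theorem IsSES.comp_epi {K P X M N : C} {i : K ⟶ P} {p : P ⟶ M} (h : IsSES i p)
    {f : X ⟶ M} {g : M ⟶ N} (h' : IsSES f g) :
    ∃ (E : C) (j : E ⟶ P) (a : K ⟶ E) (b : E ⟶ X), IsSES j (p ≫ g) ∧ IsSES a b := by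
  have := h.epi
  have := h'.epi
  have := h.mono
  have := h'.mono
  obtain ⟨a, ha⟩ := (isSES_kernel (p ≫ g)).exists_lift i (by rw [← assoc, h.w, zero_comp])
  obtain ⟨b, hb⟩ := h'.exists_lift (kernel.ι (p ≫ g) ≫ p) (by rw [assoc, kernel.condition])
  have : Mono a := by
    have : Mono (a ≫ kernel.ι (p ≫ g)) := by rw [ha]; infer_instance
    exact mono_of_mono a (kernel.ι (p ≫ g))
  have hsq : IsPullback (kernel.ι (p ≫ g)) b p f := by
    refine ⟨⟨hb.symm⟩, ⟨PullbackCone.IsLimit.mk _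
      (fun s => kernel.lift (p ≫ g) s.fst (by rw [← assoc, s.condition, assoc, h'.w, comp_zero]))
      (fun s => kernel.lift_ι _ _ _) (fun s => ?_) fun s m hm _ => ?_⟩⟩
    · rw [← cancel_mono f, assoc, hb, ← assoc, kernel.lift_ι, s.condition]
    · rw [← cancel_mono (kernel.ι (p ≫ g)), kernel.lift_ι, hm]
  have : Epi b := by
    have := Abelian.epi_pullback_of_epi_f p f
    have e : hsq.isoPullback.hom ≫ pullback.snd p f = b := hsq.isoPullback_hom_snd
    rw [← e]
    infer_instance
  refine ⟨_, kernel.ι (p ≫ g), a, b, isSES_kernel (p ≫ g), IsSES.of_exists_lift ?_ fun A k hk => ?_⟩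
  · rw [← cancel_mono f, assoc, hb, ← assoc, ha, h.w, zero_comp]
  · obtain ⟨l, hl⟩ := h.exists_lift (k ≫ kernel.ι (p ≫ g)) (by
      rw [assoc, ← hb, ← assoc, hk, zero_comp])
    exact ⟨l, by rw [← cancel_mono (kernel.ι (p ≫ g)), assoc, ha, hl]⟩

/-- The pullback of an extension along an epimorphism. -/
theorem IsSES.exists_pullback {X Y Z K P : C} {f : X ⟶ Y} {g : Y ⟶ Z} (h : IsSES f g)
    {i : K ⟶ P} {p : P ⟶ Z} (h' : IsSES i p) :
    ∃ (E : C) (a : X ⟶ E) (b : E ⟶ P) (c : K ⟶ E) (d : E ⟶ Y), IsSES a b ∧ IsSES c d := by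
  have := h.epi
  have := h'.epi
  have := h.mono
  have := h'.mono
  obtain ⟨a, ha₁, ha₂⟩ : ∃ a : X ⟶ pullback g p, a ≫ pullback.fst g p = f ∧
      a ≫ pullback.snd g p = 0 :=
    ⟨pullback.lift f 0 (by rw [h.w, zero_comp]), pullback.lift_fst _ _ _, pullback.lift_snd _ _ _⟩
  obtain ⟨c, hc₁, hc₂⟩ : ∃ c : K ⟶ pullback g p, c ≫ pullback.fst g p = 0 ∧
      c ≫ pullback.snd g p = i :=
    ⟨pullback.lift 0 i (by rw [h'.w, zero_comp]), pullback.lift_fst _ _ _, pullback.lift_snd _ _ _⟩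
  have : Mono a := by
    have : Mono (a ≫ pullback.fst g p) := by rw [ha₁]; infer_instance
    exact mono_of_mono _ (pullback.fst g p)
  have : Mono c := by
    have : Mono (c ≫ pullback.snd g p) := by rw [hc₂]; infer_instance
    exact mono_of_mono _ (pullback.snd g p)
  refine ⟨pullback g p, a, pullback.snd g p, c, pullback.fst g p,
    IsSES.of_exists_lift ha₂ fun A k hk => ?_, IsSES.of_exists_lift hc₁ fun A k hk => ?_⟩
  · obtain ⟨l, hl⟩ := h.exists_lift (k ≫ pullback.fst g p) (by
      rw [assoc, pullback.condition, ← assoc, hk, zero_comp])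
    exact ⟨l, by apply pullback.hom_ext <;> simp [hl, hk, ha₁, ha₂]⟩
  · obtain ⟨l, hl⟩ := h'.exists_lift (k ≫ pullback.snd g p) (by
      rw [assoc, ← pullback.condition, ← assoc, hk, zero_comp])
    exact ⟨l, by apply pullback.hom_ext <;> simp [hl, hk, hc₁, hc₂]⟩

/-- The horseshoe lemma. -/
theorem IsSES.horseshoe {X Y Z K P K' P' : C} {f : X ⟶ Y} {g : Y ⟶ Z} (h : IsSES f g)
    {i : K ⟶ P} {p : P ⟶ X} (hp : IsSES i p) {i' : K' ⟶ P'} {p' : P' ⟶ Z} (hp' : IsSES i' p')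
    [Projective P'] :
    ∃ (E : C) (j : E ⟶ P ⊞ P') (q : P ⊞ P' ⟶ Y) (a : K ⟶ E) (b : E ⟶ K'),
      IsSES j q ∧ IsSES a b := by
  have := h.epi
  have := hp.epi
  have := hp'.epi
  have := h.mono
  have := hp.mono
  have := hp'.mono
  let s : P' ⟶ Y := Projective.factorThru p' g
  have hs : s ≫ g = p' := Projective.factorThru_comp p' g
  obtain ⟨t, ht⟩ := h.exists_lift (i' ≫ s) (by rw [assoc, hs, hp'.w])
  have : Mono (biprod.lift (-t) i') := by
    have : Mono (biprod.lift (-t) i' ≫ biprod.snd) := by rw [biprod.lift_snd]; infer_instance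
    exact mono_of_mono _ biprod.snd
  have : Epi (biprod.desc f s) := by
    refine Preadditive.epi_of_cancel_zero _ fun k hk => ?_
    have h1 : f ≫ k = 0 := by rw [← biprod.inl_desc f s, assoc, hk, comp_zero]
    have h2 : s ≫ k = 0 := by rw [← biprod.inr_desc f s, assoc, hk, comp_zero]
    obtain ⟨l, rfl⟩ := h.exists_desc k h1
    rw [← assoc, hs] at h2
    rw [(cancel_epi p').1 (h2.trans comp_zero.symm), comp_zero]
  -- Only the right-hand cover is used at first, giving 0 → K' → X ⊞ P' → Y → 0. Replacing X by its
  -- cover P is then a composition of epimorphisms, so P need not be projective.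
  have h₁ : IsSES (biprod.lift (-t) i') (biprod.desc f s) := by
    refine IsSES.of_exists_lift (by rw [biprod.lift_desc, Preadditive.neg_comp, ht]; simp)
      fun A k hk => ?_
    have hk' : k ≫ biprod.fst ≫ f + k ≫ biprod.snd ≫ s = 0 := by
      rw [← hk, biprod.desc_eq, Preadditive.comp_add]
    obtain ⟨c, hc⟩ := hp'.exists_lift (k ≫ biprod.snd) (by
      have := congr_arg (· ≫ g) hk'
      simpa [h.w, hs] using this)
    refine ⟨c, ?_⟩
    apply biprod.hom_ext
    · rw [← cancel_mono f]
      simp only [assoc, biprod.lift_fst, Preadditive.comp_neg, Preadditive.neg_comp, ht]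
      rw [← assoc, hc, assoc]
      exact (eq_neg_of_add_eq_zero_left hk').symm
    · simpa using hc
  have : Epi (biprod.map p (𝟙 P')) := inferInstance
  have h₂ : IsSES (i ≫ biprod.inl) (biprod.map p (𝟙 P')) := by
    have : Mono (i ≫ (biprod.inl : P ⟶ P ⊞ P')) := mono_comp _ _
    refine IsSES.of_exists_lift (by rw [assoc, biprod.inl_map, ← assoc, hp.w, zero_comp])
      fun A k hk => ?_
    obtain ⟨l, hl⟩ := hp.exists_lift (k ≫ biprod.fst) (by
      have := congr_arg (· ≫ biprod.fst) hk
      simpa using this)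
    refine ⟨l, ?_⟩
    apply biprod.hom_ext
    · simpa using hl
    · have := congr_arg (· ≫ biprod.snd) hk
      simpa using this.symm
  obtain ⟨E, j, a, b, hj, hab⟩ := h₂.comp_epi h₁
  exact ⟨E, j, _, a, b, hj, hab⟩

end Sequences

/-! ### Objects with infinite projective resolutions, treated coinductively. -/

section Resolutions

variable {C : Type u} [Category.{v} C] [Abelian C]

/-- A class of projective objects containing zero and closed under direct sums and summands. -/
structure IsProjClass (P : ObjectProperty C) : Prop where
  projective : ∀ X, P X → Projective X
  zero : ∀ X, IsZero X → P X
  biprod : ∀ X Y, P X → P Y → P (X ⊞ Y)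
  retract : ∀ X Y, Retract X Y → P Y → P X

/-- `N` has a `P`-cover with kernel in `S`. -/
def HasCover (P S : ObjectProperty C) : ObjectProperty C := fun N =>
  ∃ (K Q : C) (i : K ⟶ Q) (p : Q ⟶ N), P Q ∧ S K ∧ IsSES i p

/-- Objects with an infinite resolution by objects of `P`, defined coinductively. -/
def Res (P : ObjectProperty C) : ObjectProperty C := fun M =>
  ∃ S : ObjectProperty C, S M ∧ S ≤ HasCover P S

/-- The closure of a class of objects under extensions. -/
inductive ExtCl (S : ObjectProperty C) : C → Prop
  | of (X : C) : S X → ExtCl S X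
  | ext {X Y Z : C} (f : X ⟶ Y) (g : Y ⟶ Z) : IsSES f g → ExtCl S X → ExtCl S Z → ExtCl S Y

/-- Classes of objects closed under direct summands and with the two-out-of-three property for
short exact sequences. -/
structure IsThickClass (T : ObjectProperty C) : Prop where
  obj₁ : ∀ {X Y Z : C} {f : X ⟶ Y} {g : Y ⟶ Z}, IsSES f g → T Y → T Z → T X
  obj₂ : ∀ {X Y Z : C} {f : X ⟶ Y} {g : Y ⟶ Z}, IsSES f g → T X → T Z → T Y
  obj₃ : ∀ {X Y Z : C} {f : X ⟶ Y} {g : Y ⟶ Z}, IsSES f g → T X → T Y → T Z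
  retract : ∀ {X Y : C}, Retract X Y → T Y → T X

theorem IsThickClass.iso {T : ObjectProperty C} (hT : IsThickClass T) {X Y : C} (e : X ≅ Y)
    (hX : T X) : T Y := hT.retract e.symm.retract hX

theorem IsThickClass.inf {T T' : ObjectProperty C} (h : IsThickClass T) (h' : IsThickClass T') :
    IsThickClass (T ⊓ T') where
  obj₁ s a b := ⟨h.obj₁ s a.1 b.1, h'.obj₁ s a.2 b.2⟩
  obj₂ s a b := ⟨h.obj₂ s a.1 b.1, h'.obj₂ s a.2 b.2⟩
  obj₃ s a b := ⟨h.obj₃ s a.1 b.1, h'.obj₃ s a.2 b.2⟩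
  retract r a := ⟨h.retract r a.1, h'.retract r a.2⟩

theorem IsThickClass.unop {T : ObjectProperty Cᵒᵖ} (h : IsThickClass T) :
    IsThickClass (fun X : C => T (op X)) where
  obj₁ s a b := h.obj₃ s.op b a
  obj₂ s a b := h.obj₂ s.op b a
  obj₃ s a b := h.obj₁ s.op b a
  retract r a := h.retract r.op a

/-- Transport along exact functors. Applied to `placeFunctor` and `restr`, and in the contravariant
form to `dualFunctor`, it moves questions between A and its repetitive category. -/
theorem IsThickClass.preimage {D : Type*} [Category D] [Abelian D] {T : ObjectProperty D}
    (h : IsThickClass T) (F : C ⥤ D) (hF : ∀ {X Y Z : C} {f : X ⟶ Y} {g : Y ⟶ Z}, IsSES f g →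
      IsSES (F.map f) (F.map g)) : IsThickClass (fun X => T (F.obj X)) where
  obj₁ s a b := h.obj₁ (hF s) a b
  obj₂ s a b := h.obj₂ (hF s) a b
  obj₃ s a b := h.obj₃ (hF s) a b
  retract r a := h.retract (r.map F) a

theorem IsThickClass.preimage_op {D : Type*} [Category D] [Abelian D] {T : ObjectProperty D}
    (h : IsThickClass T) (F : Cᵒᵖ ⥤ D) (hF : ∀ {X Y Z : C} {f : X ⟶ Y} {g : Y ⟶ Z}, IsSES f g →
      IsSES (F.map g.op) (F.map f.op)) : IsThickClass (fun X => T (F.obj (op X))) where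
  obj₁ s a b := h.obj₃ (hF s) b a
  obj₂ s a b := h.obj₂ (hF s) b a
  obj₃ s a b := h.obj₁ (hF s) b a
  retract r a := h.retract (r.op.map F) a

theorem IsThickClass.zero {T : ObjectProperty C} (h : IsThickClass T) {X Z : C} (hX : T X)
    (hZ : IsZero Z) : T Z :=
  h.retract ⟨0, 0, hZ.eq_of_src _ _⟩ hX

theorem IsThickClass.biprod {T : ObjectProperty C} (h : IsThickClass T) {X Y : C} (hX : T X)
    (hY : T Y) : T (X ⊞ Y) :=
  h.obj₂ (isSES_biprod X Y) hX hY

attribute [local instance] Abelian.hasFiniteBiproducts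

/-- A class of objects containing zero and closed under isomorphisms and binary direct sums is
closed under finite direct sums. -/
theorem prop_biproduct {T : ObjectProperty C} (h0 : ∀ X, IsZero X → T X)
    (hi : ∀ {X Y : C}, (X ≅ Y) → T X → T Y) (hb : ∀ X Y, T X → T Y → T (X ⊞ Y))
    {n : ℕ} (Y : Fin n → C) (hY : ∀ i, T (Y i)) : T (⨁ Y) := by
  induction n with
  | zero =>
    refine h0 _ ((IsZero.iff_id_eq_zero _).2 ?_)
    ext j
    exact j.elim0
  | succ n ih =>
    refine hi (X := Y 0 ⊞ ⨁ fun i : Fin n => Y i.succ) ?_ (hb _ _ (hY 0) (ih _ fun i => hY i.succ))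
    refine
      { hom := biprod.desc (biproduct.ι Y 0) (biproduct.desc fun i => biproduct.ι Y i.succ)
        inv := biprod.lift (biproduct.π Y 0) (biproduct.lift fun i => biproduct.π Y i.succ)
        hom_inv_id := ?_
        inv_hom_id := ?_ }
    · ext
      · simp
      · simp [biproduct.ι_π_ne _ (Fin.succ_ne_zero _).symm]
      · simp [biproduct.ι_π_ne _ (Fin.succ_ne_zero _)]
      · rename_i i j
        by_cases hij : i = j
        · subst hij; simp
        · simp [biproduct.ι_π_ne _ hij, biproduct.ι_π_ne _ (fun h => hij (Fin.succ_injective _ h))]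
    · rw [biprod.lift_desc, biproduct.lift_desc, ← Fin.sum_univ_succ
        (f := fun i => biproduct.π Y i ≫ biproduct.ι Y i), biproduct.total]

theorem Res.hasCover {P : ObjectProperty C} {M : C} (h : Res P M) : HasCover P (Res P) M := by
  obtain ⟨S, hM, hS⟩ := h
  obtain ⟨K, Q, i, p, hQ, hK, h⟩ := hS _ hM
  exact ⟨K, Q, i, p, hQ, ⟨S, hK, hS⟩, h⟩

theorem HasCover.mono {P S S' : ObjectProperty C} (h : S ≤ S') : HasCover P S ≤ HasCover P S' :=
  fun _ ⟨K, Q, i, p, hQ, hK, hi⟩ => ⟨K, Q, i, p, hQ, h _ hK, hi⟩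

theorem res_of_hasCover {P : ObjectProperty C} {M : C} (h : HasCover P (Res P) M) : Res P M :=
  ⟨fun N => HasCover P (Res P) N, h, HasCover.mono fun _ h => h.hasCover⟩

theorem HasCover.iso {P S : ObjectProperty C} {M N : C} (h : HasCover P S M) (e : M ≅ N) :
    HasCover P S N := by
  obtain ⟨K, Q, i, p, hQ, hK, h⟩ := h
  exact ⟨K, Q, i, p ≫ e.hom, hQ, hK, h.comp_iso_right e⟩

variable {P : ObjectProperty C} (hP : IsProjClass P)

include hP

/-- By the horseshoe lemma the kernel in the middle is an extension of the outer kernels. This is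
why coinduction works with the extension closure `ExtCl S` in place of S. -/
theorem IsProjClass.hasCover_ext {S : ObjectProperty C} {X Y Z : C} {f : X ⟶ Y} {g : Y ⟶ Z}
    (h : IsSES f g) (hX : HasCover P (ExtCl S) X) (hZ : HasCover P (ExtCl S) Z) :
    HasCover P (ExtCl S) Y := by
  obtain ⟨K, Q, i, p, hQ, hK, hp⟩ := hX
  obtain ⟨K', Q', i', p', hQ', hK', hp'⟩ := hZ
  have := hP.projective _ hQ'
  obtain ⟨E, j, q, a, b, hj, hab⟩ := h.horseshoe hp hp'
  exact ⟨E, _, j, q, hP.biprod _ _ hQ hQ', .ext a b hab hK hK', hj⟩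

/-- Coinduction up to extensions. -/
theorem IsProjClass.le_res {S : ObjectProperty C}
    (hS : ∀ N, S N → ∃ (K M : C) (i : K ⟶ M) (p : M ⟶ N),
      ExtCl (S ⊔ Res P) K ∧ Res P M ∧ IsSES i p) : S ≤ Res P := by
  intro N hN
  refine ⟨ExtCl (S ⊔ Res P), .of _ (Or.inl hN), ?_⟩
  clear hN N
  intro N hN
  induction hN with
  | of N hN =>
    rcases hN with hN | hN
    · obtain ⟨K, M, i, p, hK, hM, h⟩ := hS _ hN
      -- The object M mapping onto N is only resolved, not projective. Composing with a cover Q of M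
      -- gives a cover of N whose kernel is an extension of K by the syzygy K' of M.
      obtain ⟨K', Q, i', p', hQ, hK', h'⟩ := hM.hasCover
      obtain ⟨E, j, a, b, hj, hab⟩ := h'.comp_epi h
      exact ⟨E, Q, j, _, hQ, .ext a b hab (.of _ (Or.inr hK')) hK, hj⟩
    · exact HasCover.mono (fun _ h => .of _ (Or.inr h)) _ hN.hasCover
  | ext f g h _ _ ihX ihZ => exact hP.hasCover_ext h ihX ihZ

theorem IsProjClass.extCl_res_le : ExtCl (Res P) ≤ Res P := fun N hN => by
  refine ⟨ExtCl (Res P), hN, ?_⟩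
  intro N hN
  induction hN with
  | of N hN => exact HasCover.mono (fun _ h => .of _ h) _ hN.hasCover
  | ext f g h _ _ ihX ihZ => exact hP.hasCover_ext h ihX ihZ

theorem IsProjClass.res_of_prop {X : C} (hX : P X) : Res P X := by
  obtain ⟨Z, hZ⟩ := HasZeroObject.zero (C := C)
  refine ⟨P, hX, fun Y hY => ⟨Z, Y, 0, 𝟙 Y, hY, hP.zero _ hZ, ?_⟩⟩
  have : Mono (0 : Z ⟶ Y) := ⟨fun _ _ _ => hZ.eq_of_tgt _ _⟩
  exact IsSES.of_exists_lift zero_comp fun A k hk => ⟨0, by simpa using hk.symm⟩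

theorem IsProjClass.res_obj₂ {X Y Z : C} {f : X ⟶ Y} {g : Y ⟶ Z} (h : IsSES f g)
    (hX : Res P X) (hZ : Res P Z) : Res P Y :=
  hP.extCl_res_le _ (.ext f g h (.of _ hX) (.of _ hZ))

/-- A cover of Y also covers Z, and its kernel over Z is an extension of X by the syzygy of Y. -/
theorem IsProjClass.res_obj₃ {X Y Z : C} {f : X ⟶ Y} {g : Y ⟶ Z} (h : IsSES f g)
    (hX : Res P X) (hY : Res P Y) : Res P Z := by
  obtain ⟨K, Q, i, p, hQ, hK, hp⟩ := hY.hasCover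
  obtain ⟨E, j, a, b, hj, hab⟩ := hp.comp_epi h
  exact res_of_hasCover ⟨E, Q, j, _, hQ, hP.res_obj₂ hab hK hX, hj⟩

theorem IsProjClass.prop_kernel {X Y Z : C} {f : X ⟶ Y} {g : Y ⟶ Z} (h : IsSES f g)
    (hY : P Y) (hZ : P Z) : P X := by
  have := hP.projective _ hZ
  have := h.epi
  have := h.mono
  let s := Projective.factorThru (𝟙 Z) g
  have hs : s ≫ g = 𝟙 Z := Projective.factorThru_comp _ _
  obtain ⟨r, hr⟩ := h.exists_lift (𝟙 Y - g ≫ s) (by simp [hs])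
  exact hP.retract X Y ⟨f, r, by rw [← cancel_mono f, assoc, hr]; simp [reassoc_of% h.w]⟩ hY

/-- Pulling Y back along a cover Q → Z gives E, an extension of Y by the syzygy of Z and of Q by X.
If Q' covers E, then Q' → Q is a split epimorphism; its kernel is in P, and it covers X with the
same kernel as Q' → E. -/
theorem IsProjClass.res_obj₁ {X Y Z : C} {f : X ⟶ Y} {g : Y ⟶ Z} (h : IsSES f g)
    (hY : Res P Y) (hZ : Res P Z) : Res P X := by
  obtain ⟨K, Q, i, p, hQ, hK, hp⟩ := hZ.hasCover
  obtain ⟨E, a, b, c, d, hab, hcd⟩ := h.exists_pullback hp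
  have hE := hP.res_obj₂ hcd hK hY
  obtain ⟨K', Q', i', p', hQ', hK', hp'⟩ := hE.hasCover
  obtain ⟨E', j, a', b', hj, hab'⟩ := hp'.comp_epi hab
  exact res_of_hasCover ⟨K', E', a', b', hP.prop_kernel hj hQ' hQ, hK', hab'⟩

theorem IsProjClass.prop_ext {X Y Z : C} {f : X ⟶ Y} {g : Y ⟶ Z} (h : IsSES f g)
    (hX : P X) (hZ : P Z) : P Y := by
  have := hP.projective _ hZ
  have := h.epi
  let s := Projective.factorThru (𝟙 Z) g
  have hs : s ≫ g = 𝟙 Z := Projective.factorThru_comp _ _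
  obtain ⟨r, hr⟩ := h.exists_lift (𝟙 Y - g ≫ s) (by simp [hs])
  exact hP.retract Y (X ⊞ Z) ⟨biprod.lift r g, biprod.desc f s, by simp [hr]⟩ (hP.biprod _ _ hX hZ)

/-- Makes every closure property of `Res` available for coresolutions, as resolutions in the
opposite category. -/
theorem IsProjClass.op (hI : ∀ X, P X → Injective X) : IsProjClass P.op where
  projective X hX := by
    have := hI _ hX
    exact inferInstanceAs (Projective (Opposite.op X.unop))
  zero _ h := hP.zero _ h.unop
  biprod X Y hX hY := hP.prop_ext (isSES_biprod X Y).unop hY hX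
  retract X Y r hY := hP.retract _ _
    ⟨r.r.unop, r.i.unop, by rw [← unop_comp, r.retract]; rfl⟩ hY

/-- The kernel of the retraction Y → X is the complementary summand of Y, so summands of resolved
objects are covered by resolved objects with kernels of the same kind. Coinduction does the rest. -/
theorem IsProjClass.res_retract {X Y : C} (r : Retract X Y) (hY : Res P Y) : Res P X := by
  refine hP.le_res (S := fun X => ∃ Y, Res P Y ∧ Nonempty (Retract X Y)) ?_ X ⟨Y, hY, ⟨r⟩⟩
  clear! X Y
  rintro X ⟨Y, hY, ⟨r⟩⟩
  have : Epi r.r := inferInstance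
  refine ⟨kernel r.r, Y, kernel.ι r.r, r.r, .of _ (Or.inl ⟨Y, hY, ⟨⟨kernel.ι r.r,
    kernel.lift r.r (𝟙 Y - r.r ≫ r.i) (by simp), ?_⟩⟩⟩), hY, isSES_kernel r.r⟩
  rw [← cancel_mono (kernel.ι r.r)]
  simp

theorem IsProjClass.isThickClass_res : IsThickClass (Res P) where
  obj₁ h := hP.res_obj₁ h
  obj₂ h := hP.res_obj₂ h
  obj₃ h := hP.res_obj₃ h
  retract r := hP.res_retract r

/-- Let `G j` be exact on objects, and let every generator `g` have a cover of `G j g` whose kernel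
is some `G j' D` with `D` resolved. Then `G j` preserves resolved objects. -/
theorem IsProjClass.res_obj_of_generators {B : Type*} [Category B] [Abelian B]
    {Q : ObjectProperty B} {J : Type*} (G : J → B → C)
    (hG : ∀ j {X Y Z : B} (f : X ⟶ Y) (g : Y ⟶ Z), IsSES f g →
      ∃ (f' : G j X ⟶ G j Y) (g' : G j Y ⟶ G j Z), IsSES f' g')
    (gen : ObjectProperty B) (hgen : ∀ N, Res Q N → HasCover gen (Res Q) N)
    (h : ∀ j g, gen g → HasCover P (fun K => ∃ j' D, Res Q D ∧ K = G j' D) (G j g))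
    (j : J) (N : B) (hN : Res Q N) : Res P (G j N) := by
  refine ⟨ExtCl (fun K => ∃ j D, Res Q D ∧ K = G j D), .of _ ⟨j, N, hN, rfl⟩, ?_⟩
  clear hN N j
  intro N hN
  induction hN with
  | of N hN =>
    obtain ⟨j, N, hN, rfl⟩ := hN
    obtain ⟨K, g, i, p, hg, hK, hp⟩ := hgen _ hN
    obtain ⟨K', R, i', p', hR, hK', hp'⟩ := h j g hg
    obtain ⟨i'', p'', hp''⟩ := hG j _ _ hp
    obtain ⟨E, e, a, b, he, hab⟩ := hp'.comp_epi hp''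
    exact ⟨E, R, e, _, hR, .ext a b hab (.of _ hK') (.of _ ⟨j, K, hK, rfl⟩), he⟩
  | ext f g h _ _ ihX ihZ => exact hP.hasCover_ext h ihX ihZ

end Resolutions

end FrobStable

namespace FrobStable

/-! ### Sequences of syzygies and cosyzygies. -/

section Sequences

variable {C : Type u} [Category.{v} C] [Abelian C]

/-- There is an exact sequence `0 ⟶ K ⟶ Q ⟶ N ⟶ 0` with `Q` in `P`. -/
def IsStep (P : ObjectProperty C) (K N : C) : Prop :=
  ∃ (Q : C) (i : K ⟶ Q) (p : Q ⟶ N), P Q ∧ IsSES i p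

variable {P : ObjectProperty C}

theorem IsStep.op {K N : C} (h : IsStep P K N) : IsStep P.op (op N) (op K) := by
  obtain ⟨Q, i, p, hQ, h⟩ := h
  exact ⟨Opposite.op Q, p.op, i.op, hQ, h.op⟩

theorem IsStep.unop {K N : Cᵒᵖ} (h : IsStep P.op K N) : IsStep P N.unop K.unop := by
  obtain ⟨Q, i, p, hQ, h⟩ := h
  exact ⟨Q.unop, p.unop, i.unop, hQ, h.unop⟩

theorem IsSES.isExactAt {X Y Z X' Z' : C} {f : X ⟶ Y} {g : Y ⟶ Z} (h : IsSES f g)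
    (e : X' ⟶ X) [Epi e] (m : Z ⟶ Z') [Mono m] : IsExactAt (e ≫ f) (g ≫ m) := by
  obtain ⟨w, h⟩ := h
  have w₁ : (e ≫ f) ≫ g = 0 := by rw [assoc, w, comp_zero]
  have w₂ : (e ≫ f) ≫ g ≫ m = 0 := by rw [← assoc, w₁, zero_comp]
  let φ : ShortComplex.mk _ _ w₁ ⟶ ShortComplex.mk _ _ w :=
    { τ₁ := e, τ₂ := 𝟙 _, τ₃ := 𝟙 _ }
  let ψ : ShortComplex.mk _ _ w₁ ⟶ ShortComplex.mk _ _ w₂ :=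
    { τ₁ := 𝟙 _, τ₂ := 𝟙 _, τ₃ := m }
  have : Epi φ.τ₁ := inferInstanceAs (Epi e)
  have : IsIso φ.τ₂ := inferInstanceAs (IsIso (𝟙 Y))
  have : Mono φ.τ₃ := inferInstanceAs (Mono (𝟙 Z))
  have : Epi ψ.τ₁ := inferInstanceAs (Epi (𝟙 X'))
  have : IsIso ψ.τ₂ := inferInstanceAs (IsIso (𝟙 Y))
  have : Mono ψ.τ₃ := inferInstanceAs (Mono m)
  exact ⟨w₂, (ShortComplex.exact_iff_of_epi_of_isIso_of_mono ψ).1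
    ((ShortComplex.exact_iff_of_epi_of_isIso_of_mono φ).2 h.exact)⟩

theorem IsExactAt.isSES_kernel_lift {X Y Z : C} {f : X ⟶ Y} {g : Y ⟶ Z} (h : IsExactAt f g) :
    IsSES (kernel.ι f) (kernel.lift g f h.1) := by
  obtain ⟨w, h⟩ := h
  have : Epi (kernel.lift g f w) := (ShortComplex.mk f g w).exact_iff_epi_kernel_lift.1 h
  exact IsSES.of_exists_lift (by rw [← cancel_mono (kernel.ι g)]; simp) fun A k hk =>
    ⟨kernel.lift f k (by rw [← kernel.lift_ι g f w, ← assoc, hk, zero_comp]), kernel.lift_ι _ _ _⟩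

theorem exists_sequence_of_le_hasCover {S : ObjectProperty C} (hS : S ≤ HasCover P S) {M : C}
    (h : S M) : ∃ N : ℕ → C, N 0 = M ∧ (∀ n, S (N n)) ∧ ∀ n, IsStep P (N (n + 1)) (N n) := by
  choose K Q i p hQ hK hi using fun X : Subtype S => hS _ X.2
  let N : ℕ → Subtype S := fun n => Nat.rec ⟨M, h⟩ (fun _ X => ⟨K X, hK X⟩) n
  exact ⟨fun n => (N n).1, rfl, fun n => (N n).2,
    fun n => ⟨Q (N n), i (N n), p (N n), hQ _, hi _⟩⟩

theorem Res.exists_sequence {M : C} (h : Res P M) :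
    ∃ N : ℕ → C, N 0 = M ∧ ∀ n, IsStep P (N (n + 1)) (N n) := by
  obtain ⟨N, h₀, -, hN⟩ := exists_sequence_of_le_hasCover (fun _ h => h.hasCover) h
  exact ⟨N, h₀, hN⟩

theorem res_of_sequence {J : Type*} (N : J → C) (h : ∀ j, ∃ j', IsStep P (N j') (N j)) (j : J) :
    Res P (N j) := by
  refine ⟨fun X => ∃ j, X = N j, ⟨j, rfl⟩, ?_⟩
  rintro _ ⟨j, rfl⟩
  obtain ⟨j', Q, i, p, hQ, hi⟩ := h j
  exact ⟨_, Q, i, p, hQ, ⟨j', rfl⟩, hi⟩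

/-- An object has an infinite `P`-resolution and an infinite `P`-coresolution if and only if it is
a term of a doubly infinite sequence of `P`-syzygies. -/
theorem exists_int_sequence_iff {M : C} :
    (∃ Z : ℤ → C, Z 1 = M ∧ ∀ i, IsStep P (Z i) (Z (i + 1))) ↔
      Res P M ∧ Res P.op (op M) := by
  constructor
  · rintro ⟨Z, rfl, hZ⟩
    refine ⟨res_of_sequence Z (fun j => ⟨j - 1, ?_⟩) 1,
      res_of_sequence (fun i => op (Z i)) (fun j => ⟨j + 1, (hZ j).op⟩) 1⟩
    have := hZ (j - 1)
    rwa [sub_add_cancel] at this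
  · rintro ⟨h, h'⟩
    obtain ⟨N, hN, hN'⟩ := h.exists_sequence
    obtain ⟨L, hL, hL'⟩ := h'.exists_sequence
    -- Index 0 carries M, where the two sequences meet. The final shift by one puts M at index 1,
    -- matching the convention that a Gorenstein-projective module is the image of d⁰, which is the
    -- kernel of d¹.
    let Z : ℤ → C := fun i => match i with
      | Int.ofNat n => (L n).unop
      | Int.negSucc n => N (n + 1)
    have hZ : ∀ i, IsStep P (Z i) (Z (i + 1)) := by
      rintro (n | n)
      · exact (hL' n).unop
      · obtain _ | n := n
        · have : (L 0).unop = N 0 := by rw [hL, hN]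
          change IsStep P (N 1) (L 0).unop
          rw [this]
          exact hN' 0
        · exact hN' (n + 1)
    refine ⟨fun i => Z (i - 1), ?_, fun i => ?_⟩
    · change (L 0).unop = M
      rw [hL]
    · have := hZ (i - 1)
      rwa [show i - 1 + 1 = i + 1 - 1 by ring] at this

theorem acyclic_isExactAt {K : CochainComplex C ℤ} (h : K.Acyclic) (i : ℤ) :
    IsExactAt (K.d i (i + 1)) (K.d (i + 1) (i + 1 + 1)) :=
  ⟨K.d_comp_d _ _ _, (K.exactAt_iff' i (i + 1) (i + 1 + 1) (by simp) (by simp)).1 (h (i + 1))⟩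

end Sequences

/-! ### Vanishing of stable morphisms, Frobenius pairs and a criterion for tilting. -/

section StableZero

variable {C : Type u} [Category.{v} C] {P : ObjectProperty C}

/-- All morphisms `X ⟶ Y` factor through objects of `P`. -/
def StZero (P : ObjectProperty C) (X Y : C) : Prop :=
  ∀ f : X ⟶ Y, ∃ (Q : C) (a : X ⟶ Q) (b : Q ⟶ Y), P Q ∧ f = a ≫ b

theorem StZero.retract_left {X X' Y : C} (r : Retract X X') (h : StZero P X' Y) : StZero P X Y := by
  intro f
  obtain ⟨Q, a, b, hQ, hf⟩ := h (r.r ≫ f)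
  exact ⟨Q, r.i ≫ a, b, hQ, by rw [assoc, ← hf, r.retract_assoc]⟩

theorem StZero.retract_right {X Y Y' : C} (r : Retract Y Y') (h : StZero P X Y') :
    StZero P X Y := by
  intro f
  obtain ⟨Q, a, b, hQ, hf⟩ := h (f ≫ r.i)
  exact ⟨Q, a, b ≫ r.r, hQ, by rw [← assoc, ← hf, assoc, r.retract, comp_id]⟩

end StableZero

section Frobenius

variable {C : Type u} [Category.{v} C] [Abelian C] {P F : ObjectProperty C}

/-- A thick class `F` of objects, with a subclass `P` of projective and injective objects such that
all objects of `F` have a `P`-cover and a `P`-hull with (co)kernel in `F`. -/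
structure IsFrobeniusPair (P F : ObjectProperty C) : Prop where
  projClass : IsProjClass P
  injective : ∀ X, P X → Injective X
  thick : IsThickClass F
  le : P ≤ F
  exists_cover : ∀ X, F X → ∃ K, F K ∧ IsStep P K X
  exists_hull : ∀ X, F X → ∃ L, F L ∧ IsStep P X L

namespace IsFrobeniusPair

variable (h : IsFrobeniusPair P F)

include h

theorem isRelProjective_eq : IsRelProjective F = P := by
  ext Z
  constructor
  · rintro ⟨hZ, hs⟩
    obtain ⟨K, hK, Q, i, p, hQ, hp⟩ := h.exists_cover Z hZ
    obtain ⟨s, hs⟩ := hs i p ⟨hp, hK, h.le _ hQ, hZ⟩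
    exact h.projClass.retract Z Q ⟨s, p, hs⟩ hQ
  · intro hZ
    have := h.projClass.projective Z hZ
    refine ⟨h.le _ hZ, fun X Y f g hs => ?_⟩
    have := hs.ses.epi
    exact ⟨Projective.factorThru (𝟙 Z) g, Projective.factorThru_comp _ _⟩

theorem isRelInjective_eq : IsRelInjective F = P := by
  ext Z
  constructor
  · rintro ⟨hZ, hs⟩
    obtain ⟨L, hL, Q, i, p, hQ, hp⟩ := h.exists_hull Z hZ
    obtain ⟨s, hs⟩ := hs i p ⟨hp, hZ, h.le _ hQ, hL⟩
    exact h.projClass.retract Z Q ⟨i, s, hs⟩ hQ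
  · intro hZ
    have := h.injective Z hZ
    refine ⟨h.le _ hZ, fun X Y f g hs => ?_⟩
    have := hs.ses.mono
    exact ⟨Injective.factorThru (𝟙 Z) f, Injective.comp_factorThru _ _⟩

theorem isFrobenius : IsFrobenius F where
  containsZero :=
    ⟨(HasZeroObject.zero (C := C)).choose, (HasZeroObject.zero (C := C)).choose_spec,
      h.le _ (h.projClass.zero _ (HasZeroObject.zero (C := C)).choose_spec)⟩
  ext := ⟨fun hs h₁ h₃ => h.thick.obj₂ ⟨_, hs⟩ h₁ h₃⟩
  enoughProjectives X hX := by
    obtain ⟨K, hK, Q, i, p, hQ, hp⟩ := h.exists_cover X hX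
    exact ⟨K, Q, i, p, ⟨hp, hK, h.le _ hQ, hX⟩, by rwa [h.isRelProjective_eq]⟩
  enoughInjectives X hX := by
    obtain ⟨L, hL, Q, i, p, hQ, hp⟩ := h.exists_hull X hX
    exact ⟨Q, L, i, p, ⟨hp, hX, h.le _ hQ, hL⟩, by rwa [h.isRelInjective_eq]⟩
  relProjective_eq_relInjective := by rw [h.isRelProjective_eq, h.isRelInjective_eq]

end IsFrobeniusPair

theorem IsProjClass.stZero_of_eq_zero (hP : IsProjClass P) {X Y : C} (h : ∀ f : X ⟶ Y, f = 0) :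
    StZero P X Y := fun f => by
  obtain ⟨Z, hZ⟩ := HasZeroObject.zero (C := C)
  exact ⟨Z, 0, 0, hP.zero _ hZ, by simp [h f]⟩

namespace IsFrobeniusPair

variable (h : IsFrobeniusPair P F)

include h

/-- Dimension shifting: stable morphisms ΩX → Y vanish exactly when stable morphisms X → ΣY do. A
morphism on one side induces one on the other through a middle map g : Q → I, by projectivity or
injectivity. When the induced map factors through R in P, the factorisation extends or lifts to the
middle terms; after subtracting it, g descends or lifts, and the original morphism factors through I
or Q. Only the sequences matter, so chosen and ad hoc syzygies can be mixed. -/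
theorem stZero_iff {K X Y L : C} (h₁ : IsStep P K X) (h₂ : IsStep P Y L) :
    StZero P K Y ↔ StZero P X L := by
  obtain ⟨Q, i, p, hQ, hp⟩ := h₁
  obtain ⟨I, j, q, hI, hq⟩ := h₂
  have := h.projClass.projective _ hQ
  have := h.injective _ hI
  have := hp.mono
  have := hp.epi
  have := hq.mono
  have := hq.epi
  constructor
  · intro H f
    let g : Q ⟶ I := Projective.factorThru (p ≫ f) q
    have hg : g ≫ q = p ≫ f := Projective.factorThru_comp _ _
    obtain ⟨l, hl⟩ := hq.exists_lift (i ≫ g) (by rw [assoc, hg, ← assoc, hp.w, zero_comp])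
    obtain ⟨R, a, b, hR, rfl⟩ := H l
    have := h.injective _ hR
    let a' : Q ⟶ R := Injective.factorThru a i
    have ha' : i ≫ a' = a := Injective.comp_factorThru _ _
    obtain ⟨s, hs⟩ := hp.exists_desc (g - a' ≫ b ≫ j) (by
      rw [Preadditive.comp_sub, ← hl, reassoc_of% ha', assoc, sub_self])
    refine ⟨I, s, q, hI, ?_⟩
    rw [← cancel_epi p, reassoc_of% hs, Preadditive.sub_comp, hg]
    simp [hq.w]
  · intro H f
    let g : Q ⟶ I := Injective.factorThru (f ≫ j) i
    have hg : i ≫ g = f ≫ j := Injective.comp_factorThru _ _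
    obtain ⟨l, hl⟩ := hp.exists_desc (g ≫ q) (by rw [reassoc_of% hg, hq.w, comp_zero])
    obtain ⟨R, a, b, hR, rfl⟩ := H l
    have := h.projClass.projective _ hR
    let b' : R ⟶ I := Projective.factorThru b q
    have hb' : b' ≫ q = b := Projective.factorThru_comp _ _
    obtain ⟨s, hs⟩ := hq.exists_lift (g - p ≫ a ≫ b') (by
      rw [Preadditive.sub_comp, ← hl, assoc, assoc, hb', sub_self])
    refine ⟨Q, i, s, hQ, ?_⟩
    rw [← cancel_mono j, assoc, hs, Preadditive.comp_sub, hg]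
    simp [reassoc_of% hp.w]

theorem isStep_susp (hF : IsFrobenius F) (X : F.FullSubcategory) :
    IsStep P X.obj (hF.suspObj X).obj :=
  ⟨_, _, _, by have := (hF.injSES X).inj; rwa [h.isRelInjective_eq] at this, (hF.injSES X).ses.ses⟩

theorem isStep_loop (hF : IsFrobenius F) (X : F.FullSubcategory) :
    IsStep P (hF.loopObj X).obj X.obj :=
  ⟨_, _, _, by have := (hF.projSES X).proj; rwa [h.isRelProjective_eq] at this,
    (hF.projSES X).ses.ses⟩

theorem stZero_susp_iterate (hF : IsFrobenius F) {K : ℕ → C}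
    (hK : ∀ n, IsStep P (K (n + 1)) (K n)) (n : ℕ) (Y : Stable F)
    (H : StZero P (K n) Y.as.obj) :
    StZero P (K 0) ((fun Y : Stable F => hF.susp.obj Y)^[n] Y).as.obj := by
  induction n generalizing Y with
  | zero => exact H
  | succ n ih => exact ih _ ((h.stZero_iff (hK n) (h.isStep_susp hF Y.as)).1 H)

theorem stZero_loop_iterate (hF : IsFrobenius F) {X : ℕ → C}
    (hX : ∀ n, IsStep P (X n) (X (n + 1))) (n : ℕ) (Y : Stable F)
    (H : StZero P (X n) Y.as.obj) :
    StZero P (X 0) ((fun Y : Stable F => (⟨hF.loopObj Y.as⟩ : Stable F))^[n] Y).as.obj := by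
  induction n generalizing Y with
  | zero => exact H
  | succ n ih => exact ih _ ((h.stZero_iff (hX n) (h.isStep_loop hF Y.as)).2 H)

theorem stZero_syzygy_cosyzygy {X K : ℕ → C} (hX : ∀ n, IsStep P (X n) (X (n + 1)))
    (hK : ∀ n, IsStep P (K (n + 1)) (K n)) (m n : ℕ) (H : StZero P (X m) (K n)) :
    StZero P (X (m + n)) (K 0) := by
  induction n generalizing m with
  | zero => exact H
  | succ n ih =>
    have := ih (m + 1) ((h.stZero_iff (hX m) (hK n)).1 H)
    rwa [show m + (n + 1) = m + 1 + n by ring]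

theorem subsingleton_hom {X Y : Stable F} (H : StZero P X.as.obj Y.as.obj) :
    Subsingleton (X ⟶ Y) := by
  refine ⟨fun f g => ?_⟩
  obtain ⟨f, rfl⟩ := (Quotient.functor (stableRel F)).map_surjective f
  obtain ⟨g, rfl⟩ := (Quotient.functor (stableRel F)).map_surjective g
  obtain ⟨Q, a, b, hQ, e⟩ := H (f.hom - g.hom)
  exact CategoryTheory.Quotient.sound _ ⟨Q, by rwa [h.isRelProjective_eq], a, b, e⟩

/-- The objects of `F` that are in a thick subcategory of the stable category form a thick class. -/
theorem isThickClass_of_isThick (hF : IsFrobenius F) {U : ObjectProperty (Stable F)}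
    (hU : hF.IsThick U) : IsThickClass fun X => ∃ hX : F X, U (Stable.of hX) := by
  have key : ∀ {X Y Z : C} {f : X ⟶ Y} {g : Y ⟶ Z} (hs : IsSES f g) (hX : F X) (hY : F Y)
      (hZ : F Z), ∃ (c : Stable.of hZ ⟶ hF.susp.obj (Stable.of hX)),
      hF.IsDistinguished (Stable.ofHom hX hY f) (Stable.ofHom hY hZ g) c := by
    intro X Y Z f g hs hX hY hZ
    obtain ⟨y, hy⟩ := (hF.injSES ⟨X, hX⟩).inj.exists_extension hF.ext ⟨hs, hX, hY, hZ⟩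
      (hF.injSES ⟨X, hX⟩).i
    obtain ⟨l, hl⟩ := hs.exists_desc (y ≫ (hF.injSES ⟨X, hX⟩).p) (by
      rw [← assoc, hy, (hF.injSES ⟨X, hX⟩).ses.ses.w])
    let l' : (⟨Z, hZ⟩ : F.FullSubcategory) ⟶ hF.suspObj ⟨X, hX⟩ := ObjectProperty.homMk l
    refine ⟨(Quotient.functor (stableRel F)).map (-l'), ⟨X, hX⟩, ⟨Y, hY⟩, ⟨Z, hZ⟩,
      ObjectProperty.homMk f, ObjectProperty.homMk g, l', ⟨⟨hs, hX, hY, hZ⟩, y, hy, hl⟩,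
      Iso.refl _, Iso.refl _, Iso.refl _, ?_, ?_, ?_⟩
    · exact (comp_id _).trans (id_comp _).symm
    · exact (comp_id _).trans (id_comp _).symm
    · rw [Iso.refl_hom, Iso.refl_hom, CategoryTheory.Functor.map_id]
      exact (comp_id _).trans (id_comp _).symm
  constructor
  · rintro X Y Z f g hs ⟨hY, hY'⟩ ⟨hZ, hZ'⟩
    have hX := h.thick.obj₁ hs hY hZ
    obtain ⟨c, hc⟩ := key hs hX hY hZ
    exact ⟨hX, hU.obj₁ _ _ _ hc hY' hZ'⟩
  · rintro X Y Z f g hs ⟨hX, hX'⟩ ⟨hZ, hZ'⟩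
    have hY := h.thick.obj₂ hs hX hZ
    obtain ⟨c, hc⟩ := key hs hX hY hZ
    exact ⟨hY, hU.obj₂ _ _ _ hc hX' hZ'⟩
  · rintro X Y Z f g hs ⟨hX, hX'⟩ ⟨hY, hY'⟩
    have hZ := h.thick.obj₃ hs hX hY
    obtain ⟨c, hc⟩ := key hs hX hY hZ
    exact ⟨hZ, hU.obj₃ _ _ _ hc hX' hY'⟩
  · rintro X Y r ⟨hY, hY'⟩
    have hX := h.thick.retract r hY
    have := hU.retract
    let r' : Retract (⟨X, hX⟩ : F.FullSubcategory) ⟨Y, hY⟩ :=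
      ⟨ObjectProperty.homMk r.i, ObjectProperty.homMk r.r, by ext; exact r.retract⟩
    exact ⟨hX, U.prop_of_retract (r'.map (Quotient.functor (stableRel F))) hY'⟩

/-- Reduces tilting to the abelian category. It suffices that each object of M is a summand of some
K 0 whose higher syzygies have no nonzero morphisms to or from M, and that F is generated by P and M
under two-out-of-three and summands. -/
theorem isTilting (hF : IsFrobenius F) (M : ObjectProperty C)
    (hom_zero : ∀ X, M X → ∃ K : ℕ → C, Nonempty (Retract X (K 0)) ∧
      (∀ n, IsStep P (K (n + 1)) (K n)) ∧
      ∀ n Y, M Y → (∀ f : K (n + 1) ⟶ Y, f = 0) ∧ ∀ f : Y ⟶ K (n + 1), f = 0)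
    (gen : ∀ T : ObjectProperty C, IsThickClass T → P ≤ T → M ⊓ F ≤ T → F ≤ T) :
    hF.IsTilting fun X => M X.as.obj where
  hom_shift_eq_zero X Y hX hY i hi := by
    refine h.subsingleton_hom ?_
    obtain (n | n) := i
    · obtain _ | n := n
      · exact (hi rfl).elim
      · obtain ⟨K, ⟨r⟩, hK, hK'⟩ := hom_zero _ hX
        exact StZero.retract_left r (h.stZero_susp_iterate hF hK (n + 1) Y
          (h.projClass.stZero_of_eq_zero (hK' n _ hY).1))
    · obtain ⟨K, ⟨r⟩, hK, hK'⟩ := hom_zero _ hY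
      -- The chosen loop objects of Y need not be the syzygies `K (n + 1)`. They are compared by
      -- moving Ω from Y to cosyzygies of X, passing from Y to K 0, and moving back along the
      -- sequence K.
      let L : ℕ → F.FullSubcategory := fun n => (fun Z => hF.suspObj Z)^[n] X.as
      have hL : ∀ n, IsStep P (L n).obj (L (n + 1)).obj := fun n => by
        have : L (n + 1) = hF.suspObj (L n) := Function.iterate_succ_apply' _ _ _
        rw [this]
        exact h.isStep_susp hF (L n)
      refine h.stZero_loop_iterate hF (X := fun n => (L n).obj) hL (n + 1) Y
        (StZero.retract_right r ?_)
      have := h.stZero_syzygy_cosyzygy (X := fun n => (L n).obj) hL hK 0 (n + 1)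
        (h.projClass.stZero_of_eq_zero (hK' n _ hX).2)
      rwa [zero_add] at this
  thick_eq_top := by
    refine top_unique fun X _ U hU hM => ?_
    -- Objects of P are zero in the stable category, hence lie in every thick subcategory U.
    have hz : ∀ Q (hQ : P Q), IsZero (Stable.of (h.le _ hQ)) := fun Q hQ =>
      { unique_to := fun Y =>
          have := h.subsingleton_hom (X := Stable.of (h.le _ hQ)) (Y := Y)
            fun f => ⟨Q, 𝟙 Q, f, hQ, (id_comp f).symm⟩
          ⟨⟨⟨(Quotient.functor (stableRel F)).map (ObjectProperty.homMk 0)⟩,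
            fun _ => Subsingleton.elim _ _⟩⟩
        unique_from := fun Y =>
          have := h.subsingleton_hom (X := Y) (Y := Stable.of (h.le _ hQ))
            fun f => ⟨Q, f, 𝟙 Q, hQ, (comp_id f).symm⟩
          ⟨⟨⟨(Quotient.functor (stableRel F)).map (ObjectProperty.homMk 0)⟩,
            fun _ => Subsingleton.elim _ _⟩⟩ }
    obtain ⟨_, hX⟩ := gen _ (h.isThickClass_of_isThick hF hU)
      (fun Q hQ => ⟨h.le _ hQ, hU.zero _ (hz Q hQ)⟩)
      (fun Y hY => ⟨hY.2, hM _ hY.1⟩) X.as.obj X.as.property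
    exact hX

end IsFrobeniusPair

end Frobenius

end FrobStable

namespace LinMod

/-! ### Modules by elements: Yoneda, pointwise exactness, projectives and injectives. -/

section Elements

variable {k : Type v} [Field k] {A : Type u} [Category.{v} A] [Preadditive A] [Linear k A]

/-- The value of the module `M` at `X`. -/
abbrev El (M : Mod k A) (X : A) : Type v := M.obj.obj (op X)

/-- The action of a morphism `a` of `A` on a module. -/
def act (M : Mod k A) {X Y : A} (a : Y ⟶ X) : El M X →ₗ[k] El M Y := (M.obj.map a.op).hom

/-- The component of a morphism of modules. -/
def ap {M N : Mod k A} (f : M ⟶ N) (X : A) : El M X →ₗ[k] El N X := (f.hom.app (op X)).hom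

@[simp] theorem act_id (M : Mod k A) (X : A) (x : El M X) : act M (𝟙 X) x = x := by
  simp [act]

theorem act_comp (M : Mod k A) {X Y Z : A} (a : Y ⟶ X) (b : Z ⟶ Y) (x : El M X) :
    act M (b ≫ a) x = act M b (act M a x) := by
  simp [act]

theorem act_add (M : Mod k A) {X Y : A} (a b : Y ⟶ X) (x : El M X) :
    act M (a + b) x = act M a x + act M b x := by
  have := M.property.1
  simp [act, op_add]

theorem act_smul (M : Mod k A) {X Y : A} (r : k) (a : Y ⟶ X) (x : El M X) :
    act M (r • a) x = r • act M a x := by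
  have := M.property.2
  simp [act, op_op_smul]

/-- The action of morphisms as a linear map. -/
def actₗ (M : Mod k A) {X : A} (Y : A) (x : El M X) : (Y ⟶ X) →ₗ[k] El M Y where
  toFun a := act M a x
  map_add' a b := act_add M a b x
  map_smul' r a := act_smul M r a x

theorem act_zero (M : Mod k A) {X Y : A} (x : El M X) : act M (0 : Y ⟶ X) x = 0 :=
  (actₗ M Y x).map_zero

@[simp] theorem ap_id (M : Mod k A) (X : A) (x : El M X) : ap (𝟙 M) X x = x := rfl

@[simp] theorem ap_comp {M N L : Mod k A} (f : M ⟶ N) (g : N ⟶ L) (X : A) (x : El M X) :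
    ap (f ≫ g) X x = ap g X (ap f X x) := rfl

theorem ap_add {M N : Mod k A} (f g : M ⟶ N) (X : A) (x : El M X) :
    ap (f + g) X x = ap f X x + ap g X x := rfl

@[simp] theorem ap_zero {M N : Mod k A} (X : A) (x : El M X) : ap (0 : M ⟶ N) X x = 0 := rfl

theorem ap_sum {M N : Mod k A} {ι : Type*} (s : Finset ι) (f : ι → (M ⟶ N)) (X : A) (x : El M X) :
    ap (∑ i ∈ s, f i) X x = ∑ i ∈ s, ap (f i) X x :=
  map_sum (AddMonoidHom.mk' (fun f : M ⟶ N => ap f X x) fun f g => ap_add f g X x) f s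

theorem ap_act {M N : Mod k A} (f : M ⟶ N) {X Y : A} (a : Y ⟶ X) (x : El M X) :
    ap f Y (act M a x) = act N a (ap f X x) :=
  congr_arg (fun g => g.hom x) (f.hom.naturality a.op)

theorem hom_ext_ap {M N : Mod k A} {f g : M ⟶ N} (h : ∀ X x, ap f X x = ap g X x) : f = g :=
  ObjectProperty.hom_ext _ (NatTrans.ext (funext fun X => ModuleCat.hom_ext
    (LinearMap.ext fun x => h X.unop x)))

/-- Construct a morphism of modules from its components. -/
def mkHom {M N : Mod k A} (φ : ∀ X, El M X →ₗ[k] El N X)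
    (h : ∀ {X Y : A} (a : Y ⟶ X) (x : El M X), φ Y (act M a x) = act N a (φ X x)) : M ⟶ N :=
  ObjectProperty.homMk
    { app := fun X => ModuleCat.ofHom (φ X.unop)
      naturality := fun _ _ a => ModuleCat.hom_ext (LinearMap.ext fun x => h a.unop x) }

@[simp] theorem ap_mkHom {M N : Mod k A} (φ : ∀ X, El M X →ₗ[k] El N X)
    (h : ∀ {X Y : A} (a : Y ⟶ X) (x : El M X), φ Y (act M a x) = act N a (φ X x)) (X : A)
    (x : El M X) : ap (mkHom φ h) X x = φ X x := rfl

/-- The morphism from a representable module given by an element. -/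
def yo {M : Mod k A} {X : A} (x : El M X) : representable k X ⟶ M :=
  mkHom (fun Y => actₗ M Y x) fun a b => act_comp M b a x

theorem yo_comp {M N : Mod k A} {X : A} (x : El M X) (f : M ⟶ N) : yo x ≫ f = yo (ap f X x) :=
  hom_ext_ap fun _ a => ap_act f a x

theorem yo_injective {M : Mod k A} {X : A} {x y : El M X} (h : yo x = yo y) : x = y := by
  have := congr_arg (fun f => ap f X (𝟙 X : X ⟶ X)) h
  rw [← act_id M X x, ← act_id M X y]
  exact this

theorem yo_surjective {M : Mod k A} {X : A} (f : representable k X ⟶ M) : ∃ x, f = yo x := by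
  refine ⟨ap f X (𝟙 X : X ⟶ X), hom_ext_ap fun Y a => ?_⟩
  refine Eq.trans ?_ (ap_act f (show Y ⟶ X from a) (show El (representable k X) X from 𝟙 X))
  congr 1
  exact (comp_id (show Y ⟶ X from a)).symm

theorem mono_iff {M N : Mod k A} (f : M ⟶ N) : Mono f ↔ ∀ X, Function.Injective (ap f X) := by
  constructor
  · intro _ X x y h
    apply yo_injective
    rw [← cancel_mono f, yo_comp, yo_comp, h]
  · intro h
    refine ⟨fun a b e => hom_ext_ap fun X x => h X ?_⟩
    rw [← ap_comp, e, ap_comp]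

theorem epi_iff {M N : Mod k A} (f : M ⟶ N) : Epi f ↔ ∀ X, Function.Surjective (ap f X) := by
  constructor
  · intro hf X
    have := (isLinear k A).preservesEpimorphisms_ι_of_isNormalMonoCategory
    have h : Epi f.hom := inferInstanceAs (Epi ((isLinear k A).ι.map f))
    exact (ModuleCat.epi_iff_surjective _).1 ((NatTrans.epi_iff_epi_app f.hom).1 h (op X))
  · intro h
    refine ⟨fun a b e => hom_ext_ap fun X y => ?_⟩
    obtain ⟨x, rfl⟩ := h X y
    rw [← ap_comp, e, ap_comp]

theorem isIso_iff {M N : Mod k A} (f : M ⟶ N) : IsIso f ↔ ∀ X, Function.Bijective (ap f X) := by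
  constructor
  · intro _ X
    exact ⟨(mono_iff f).1 inferInstance X, (epi_iff f).1 inferInstance X⟩
  · intro h
    have := (mono_iff f).2 fun X => (h X).1
    have := (epi_iff f).2 fun X => (h X).2
    exact isIso_of_mono_of_epi f

open FrobStable

theorem isSES_iff {M N L : Mod k A} (f : M ⟶ N) (g : N ⟶ L) :
    IsSES f g ↔ ∀ X, Function.Injective (ap f X) ∧ Function.Exact (ap f X) (ap g X) ∧
      Function.Surjective (ap g X) := by
  constructor
  · intro h X
    refine ⟨(mono_iff f).1 h.mono X, fun y => ⟨fun hy => ?_, ?_⟩, (epi_iff g).1 h.epi X⟩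
    · obtain ⟨l, hl⟩ := h.exists_lift (yo y) (by
        rw [yo_comp, hy]
        exact hom_ext_ap fun Y a => map_zero (act L _))
      obtain ⟨x, rfl⟩ := yo_surjective l
      exact ⟨x, yo_injective (by rw [← yo_comp, hl])⟩
    · rintro ⟨x, rfl⟩
      rw [← ap_comp, h.w, ap_zero]
  · intro h
    have := (mono_iff f).2 fun X => (h X).1
    have := (epi_iff g).2 fun X => (h X).2.2
    refine IsSES.of_exists_lift (hom_ext_ap fun X x => ((h X).2.1 _).2 ⟨x, rfl⟩) fun K a ha => ?_
    have hr : ∀ X x, ap a X x ∈ LinearMap.range (ap f X) := fun X x =>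
      ((h X).2.1 _).1 (by rw [← ap_comp, ha, ap_zero])
    have hl : ∀ X x, ap f X ((LinearEquiv.ofInjective (ap f X) (h X).1).symm
        ((ap a X).codRestrict _ (hr X) x)) = ap a X x := fun X x =>
      congr_arg Subtype.val ((LinearEquiv.ofInjective (ap f X) (h X).1).apply_symm_apply
        ((ap a X).codRestrict _ (hr X) x))
    exact ⟨mkHom (fun X => (LinearEquiv.ofInjective (ap f X) (h X).1).symm.toLinearMap ∘ₗ
      (ap a X).codRestrict _ (hr X)) fun {X Y} b x => (h Y).1 (by
        simp only [LinearMap.comp_apply, LinearEquiv.coe_coe]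
        rw [hl, ap_act, ap_act, hl]), hom_ext_ap hl⟩

theorem isZero_iff (M : Mod k A) : IsZero M ↔ ∀ X (x : El M X), x = 0 := by
  rw [IsZero.iff_id_eq_zero]
  exact ⟨fun h X x => by rw [← ap_id M X x, h, ap_zero], fun h => hom_ext_ap fun X x => by
    rw [ap_zero]; exact h X _⟩

instance (X : A) : Projective (representable k X) where
  factors {E M} f e _ := by
    obtain ⟨x, rfl⟩ := yo_surjective f
    obtain ⟨y, rfl⟩ := (epi_iff e).1 inferInstance X x
    exact ⟨yo y, yo_comp y e⟩

instance (X : A) : Injective (dualRepr k X) where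
  factors {M N} g f _ := by
    -- Morphisms N → D A(X,-) correspond to linear forms on N(X). The form μ of g is extended to
    -- N(X) by a linear retraction l of the injection M(X) → N(X).
    let μ : Module.Dual k (El M X) :=
      { toFun := fun m => (show Module.Dual k (X ⟶ X) from ap g X m) (𝟙 X)
        map_add' := fun m n => by rw [map_add]; rfl
        map_smul' := fun r m => by rw [map_smul]; rfl }
    obtain ⟨l, hl⟩ := LinearMap.exists_leftInverse_of_injective (ap f X)
      (LinearMap.ker_eq_bot.2 ((mono_iff f).1 inferInstance X))
    refine ⟨mkHom (fun Y =>
      { toFun := fun n => (show Module.Dual k (X ⟶ Y) from (μ ∘ₗ l) ∘ₗ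
          { toFun := fun a => act N a n
            map_add' := fun a b => act_add N a b n
            map_smul' := fun r a => act_smul N r a n })
        map_add' := fun m n => LinearMap.ext fun a => by
          simp only [LinearMap.comp_apply, LinearMap.coe_mk, AddHom.coe_mk, map_add]
          rfl
        map_smul' := fun r n => LinearMap.ext fun a => by
          simp only [LinearMap.comp_apply, LinearMap.coe_mk, AddHom.coe_mk, map_smul]
          rfl }) fun a n => LinearMap.ext fun b => ?_, hom_ext_ap fun Y m =>
        LinearMap.ext fun b => ?_⟩
    · change μ (l (act N b (act N a n))) = μ (l (act N (b ≫ a) n))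
      rw [act_comp]
    · change μ (l (act N b (ap f Y m))) = (show Module.Dual k (X ⟶ Y) from ap g Y m) b
      rw [← ap_act, show l (ap f X (act M b m)) = act M b m from LinearMap.congr_fun hl _]
      change (show Module.Dual k (X ⟶ X) from ap g X (act M b m)) (𝟙 X) = _
      rw [ap_act]
      exact congr_arg (show Module.Dual k (X ⟶ Y) from ap g Y m) (id_comp b)

end Elements

/-! ### Finitely generated modules, mod A and Gorenstein-projectives. -/

section FinitelyGenerated

variable {k : Type v} [Field k] {A : Type u} [Category.{v} A] [Preadditive A] [Linear k A]

attribute [local instance] Abelian.hasFiniteBiproducts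

open FrobStable

/-- Generation is expressed as detection of morphisms by finitely many elements. The bijection e
records which representables occur, so that the degrees of a cover can be controlled. -/
theorem isFG_of_generators {M : Mod k A} {ι : Type} [Finite ι] (X : ι → A) (m : ∀ i, El M (X i))
    (h : ∀ N : Mod k A, ∀ f g : M ⟶ N, (∀ i, ap f _ (m i) = ap g _ (m i)) → f = g) :
    ∃ (n : ℕ) (e : Fin n ≃ ι) (p : (⨁ fun i => representable k (X (e i))) ⟶ M), Epi p := by
  obtain ⟨n, ⟨e⟩⟩ := Finite.exists_equiv_fin ι
  refine ⟨n, e.symm, biproduct.desc fun i => yo (m (e.symm i)),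
    ⟨fun f g hfg => h _ f g fun i => ?_⟩⟩
  apply yo_injective
  have := congr_arg (fun a => biproduct.ι (fun i => representable k (X (e.symm i))) (e i) ≫ a) hfg
  simp only [biproduct.ι_desc_assoc] at this
  obtain ⟨j, rfl⟩ := e.symm.surjective i
  rw [← yo_comp, ← yo_comp]
  rw [Equiv.apply_symm_apply] at this
  exact this

theorem IsFG.exists_generators {M : Mod k A} (h : IsFG M) : ∃ (n : ℕ) (X : Fin n → A)
    (m : ∀ i, El M (X i)), ∀ N : Mod k A, ∀ f g : M ⟶ N, (∀ i, ap f _ (m i) = ap g _ (m i)) →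
      f = g := by
  obtain ⟨n, X, p, hp⟩ := h
  choose m hm using fun i => yo_surjective (biproduct.ι (fun i => representable k (X i)) i ≫ p)
  refine ⟨n, X, m, fun N f g hfg => ?_⟩
  rw [← cancel_epi p]
  refine biproduct.hom_ext' _ _ fun i => ?_
  rw [← assoc, ← assoc, hm, yo_comp, yo_comp, hfg]

theorem IsFG.of_epi {M N : Mod k A} (h : IsFG M) (f : M ⟶ N) [Epi f] : IsFG N := by
  obtain ⟨n, X, p, hp⟩ := h
  exact ⟨n, X, p ≫ f, epi_comp _ _⟩

theorem IsFG.biprod {M N : Mod k A} (hM : IsFG M) (hN : IsFG N) : IsFG (M ⊞ N) := by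
  obtain ⟨m, X, x, hx⟩ := hM.exists_generators
  obtain ⟨n, Y, y, hy⟩ := hN.exists_generators
  obtain ⟨l, e, p, hp⟩ := isFG_of_generators (M := M ⊞ N) (ι := Fin m ⊕ Fin n)
    (Sum.elim X Y) (fun i => match i with
      | Sum.inl i => ap biprod.inl _ (x i)
      | Sum.inr i => ap biprod.inr _ (y i)) fun L f g hfg => by
        apply biprod.hom_ext'
        · exact hx _ _ _ fun i => hfg (Sum.inl i)
        · exact hy _ _ _ fun i => hfg (Sum.inr i)
  exact ⟨l, _, p, hp⟩

theorem isFG_representable (X : A) : IsFG (representable k X) :=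
  ⟨1, fun _ => X, biproduct.desc fun _ => 𝟙 _, by
    have : Epi (biproduct.ι (fun _ : Fin 1 => representable k X) 0 ≫
        biproduct.desc fun _ : Fin 1 => 𝟙 (representable k X)) := by
      rw [biproduct.ι_desc]; infer_instance
    exact epi_of_epi (biproduct.ι (fun _ : Fin 1 => representable k X) 0) _⟩

theorem isFG_of_isZero {M : Mod k A} (h : IsZero M) : IsFG M :=
  ⟨0, Fin.elim0, 0, ⟨fun _ _ _ => h.eq_of_src _ _⟩⟩

variable (k A) in
theorem isProjClass_proj : IsProjClass (proj k A) where
  projective _ h := h.2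
  zero _ h := ⟨isFG_of_isZero h, h.projective⟩
  biprod M N hM hN := by
    have := hM.2
    have := hN.2
    exact ⟨hM.1.biprod hN.1, inferInstance⟩
  retract M N r hN := by
    have := hN.2
    have : Epi r.r := inferInstance
    exact ⟨hN.1.of_epi r.r, r.projective⟩

theorem proj_representable (X : A) : proj k A (representable k X) :=
  ⟨isFG_representable X, inferInstance⟩

/-- A class of modules that contains the representable modules, contains zero and is closed under
isomorphisms, direct sums and direct summands contains the finitely generated projective modules. -/
theorem proj_le {T : ObjectProperty (Mod k A)} (hz : ∀ X, IsZero X → T X)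
    (hb : ∀ X Y, T X → T Y → T (X ⊞ Y)) (hr : ∀ {X Y : Mod k A}, Retract X Y → T Y → T X)
    (h : ∀ X : A, T (representable k X)) : proj k A ≤ T := by
  rintro M ⟨⟨n, X, p, hp⟩, hM⟩
  refine hr (Y := ⨁ fun i => representable k (X i))
    ⟨Projective.factorThru (𝟙 M) p, p, Projective.factorThru_comp _ _⟩ ?_
  exact prop_biproduct hz (fun e h => hr e.symm.retract h) hb _ fun i => h (X i)

theorem proj_le_of_isThickClass {T : ObjectProperty (Mod k A)} (hT : IsThickClass T)
    (h0 : ∀ X, IsZero X → T X) (h : ∀ X : A, T (representable k X)) : proj k A ≤ T :=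
  proj_le h0 (fun _ _ => hT.biprod) hT.retract h

/-- Modules with a resolution by finitely generated projective modules. -/
theorem fpInf_eq_res : fpInf k A = Res (proj k A) := by
  ext M
  constructor
  · rintro ⟨P, d, ε, hP, hε, h0, hd⟩
    let N : Option ℕ → Mod k A := fun n => match n with
      | none => M
      | some 0 => kernel ε
      | some (n + 1) => kernel (d n)
    refine res_of_sequence N (fun n => ?_) none
    match n with
    | none => exact ⟨some 0, P 0, _, _, hP 0, isSES_kernel ε⟩
    | some 0 => exact ⟨some 1, P 1, _, _, hP 1, h0.isSES_kernel_lift⟩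
    | some (n + 1) => exact ⟨some (n + 2), P (n + 2), _, _, hP (n + 2), (hd n).isSES_kernel_lift⟩
  · intro h
    obtain ⟨N, rfl, hN⟩ := h.exists_sequence
    choose P i p hP h using hN
    have h1 : ∀ n, Epi (p n) := fun n => (h n).epi
    have h2 : ∀ n, Mono (i n) := fun n => (h n).mono
    refine ⟨P, fun n => p (n + 1) ≫ i n, p 0, hP, h1 0, ?_, fun n => ?_⟩
    · simpa using (h 0).isExactAt (p 1) (𝟙 _)
    · exact (h (n + 1)).isExactAt (p (n + 1 + 1)) (i n)

/-- If finitely generated projective modules are injective, then the Gorenstein-projective modules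
are those having a resolution and a coresolution by finitely generated projective modules. -/
theorem gp_iff (hinj : ∀ M, proj k A M → Injective M) (M : Mod k A) :
    GP k A M ↔ Res (proj k A) M ∧ Res (proj k A).op (op M) := by
  constructor
  · rintro ⟨K, hK, ⟨e⟩⟩
    let Z : ℤ → Mod k A := fun i => kernel (K.d i (i + 1))
    have hZ : ∀ i, IsSES (kernel.ι (K.d i (i + 1)))
        (kernel.lift (K.d (i + 1) (i + 1 + 1)) (K.d i (i + 1)) (K.d_comp_d _ _ _)) := fun i =>
      (acyclic_isExactAt hK.acyclic i).isSES_kernel_lift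
    have := (hZ 0).epi
    let e' : image (K.d 0 1) ≅ Z 1 := by
      have h : (kernel.lift (K.d (0 + 1) (0 + 1 + 1)) (K.d 0 (0 + 1)) (K.d_comp_d _ _ _)) ≫
        kernel.ι (K.d (0 + 1) (0 + 1 + 1)) = K.d 0 1 := kernel.lift_ι _ _ _
      have := strongEpi_of_epi (kernel.lift (K.d (0 + 1) (0 + 1 + 1)) (K.d 0 (0 + 1))
        (K.d_comp_d _ _ _))
      exact (image.isoStrongEpiMono _ _ h).symm
    let e'' : Z 1 ≅ M := e'.symm ≪≫ e
    have key : ∀ i, IsStep (proj k A) (Z i) (Z (i + 1)) := fun i =>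
      ⟨_, _, _, hK.proj i, hZ i⟩
    have hM := (exists_int_sequence_iff (P := proj k A) (M := Z 1)).1 ⟨Z, rfl, key⟩
    exact ⟨(hM.1.hasCover.iso e'').elim fun K h => res_of_hasCover ⟨K, h⟩,
      (hM.2.hasCover.iso e''.symm.op).elim fun K h => res_of_hasCover ⟨K, h⟩⟩
  · intro hM
    obtain ⟨Z, rfl, hZ⟩ := exists_int_sequence_iff.2 hM
    choose Q i p hQ h using hZ
    have h1 : ∀ n, Epi (p n) := fun n => (h n).epi
    have h2 : ∀ n, Mono (i n) := fun n => (h n).mono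
    let K : CochainComplex (Mod k A) ℤ := CochainComplex.of Q (fun n => p n ≫ i (n + 1)) fun n => by
      rw [assoc, reassoc_of% (h (n + 1)).w, zero_comp, comp_zero]
    have hKd : ∀ n, K.d n (n + 1) = p n ≫ i (n + 1) := fun n =>
      CochainComplex.of_d Q (fun n => p n ≫ i (n + 1)) n
    have hex : ∀ n, IsExactAt (K.d n (n + 1)) (K.d (n + 1) (n + 1 + 1)) := fun n => by
      rw [hKd, hKd]
      exact (h (n + 1)).isExactAt (p n) (i (n + 1 + 1))
    refine ⟨K, ⟨hQ, fun n => ?_, fun X n φ hφ => ?_⟩, ⟨?_⟩⟩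
    · obtain ⟨m, rfl⟩ : ∃ m, n = m + 1 := ⟨n - 1, by ring⟩
      exact (K.exactAt_iff' m (m + 1) (m + 1 + 1) (by simp) (by simp)).2 (hex m).2
    · obtain ⟨m, rfl⟩ : ∃ m, n = m + 1 := ⟨n - 1, by ring⟩
      rw [show m + 1 - 1 = m by ring, hKd, assoc] at hφ
      -- The form φ kills the incoming image, so it descends to the next cosyzygy. From there it
      -- extends to the next projective, because the representable target is injective.
      have h0 : i (m + 1) ≫ φ = 0 := by rw [← cancel_epi (p m), hφ, comp_zero]
      obtain ⟨l, hl⟩ := (h (m + 1)).exists_desc φ h0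
      have := hinj _ (proj_representable (k := k) X)
      refine ⟨Injective.factorThru l (i (m + 1 + 1)), ?_⟩
      rw [hKd, assoc, Injective.comp_factorThru, hl]
    · have := strongEpi_of_epi (p 0)
      exact (image.isoStrongEpiMono (p 0) (i 1) (hKd 0).symm).symm

end FinitelyGenerated

end LinMod

namespace LinMod

open FrobStable

/-! ### The duality between modules over A and over its opposite. -/

section Duality

variable {k : Type v} [Field k] {A : Type u} [Category.{v} A] [Preadditive A] [Linear k A]

/-- The dual `X ↦ D(N(X))` of a module over the opposite category. -/
def dualMod (N : Mod k Aᵒᵖ) : Mod k A :=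
  ⟨{ obj := fun X => ModuleCat.of k (Module.Dual k (El N X))
     map := fun f => ModuleCat.ofHom (act N f).dualMap
     map_id := fun X => by
       ext φ x
       exact congr_arg φ (act_id N X x)
     map_comp := fun f g => by
       ext φ x
       exact congr_arg φ (act_comp N g f x) },
   ⟨⟨fun {X Y f g} => by
      ext φ x
      exact (congr_arg φ (act_add N f g x)).trans (map_add φ _ _)⟩,
    ⟨fun f r => by
      ext φ x
      exact (congr_arg φ (act_smul N r f x)).trans (map_smul φ _ _)⟩⟩⟩

variable (k A) in
/-- The duality functor. -/
def dualFunctor : (Mod k Aᵒᵖ)ᵒᵖ ⥤ Mod k A where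
  obj N := dualMod N.unop
  map f := mkHom (fun X => (ap f.unop (op X)).dualMap) fun a φ =>
    LinearMap.ext fun x => congr_arg (show Module.Dual k _ from φ) (ap_act f.unop a.op x).symm
  map_id _ := rfl
  map_comp _ _ := rfl

theorem isSES_dualMod {M N L : Mod k Aᵒᵖ} {f : M ⟶ N} {g : N ⟶ L} (h : IsSES f g) :
    IsSES ((dualFunctor k A).map g.op) ((dualFunctor k A).map f.op) := by
  rw [isSES_iff] at h ⊢
  intro X
  obtain ⟨h₁, h₂, h₃⟩ := h (op X)
  refine ⟨LinearMap.dualMap_injective_of_surjective h₃, ?_,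
    LinearMap.dualMap_surjective_of_injective h₁⟩
  have h : Function.Exact (ap g (op X)).dualMap (ap f (op X)).dualMap := by
    rw [LinearMap.exact_iff, LinearMap.ker_dualMap_eq_dualAnnihilator_range,
      ← LinearMap.exact_iff.1 h₂, ← LinearMap.range_dualMap_eq_dualAnnihilator_ker]
  exact h

/-- Reversing morphisms, as a linear equivalence. -/
def opₗ (X Y : A) : (X ⟶ Y) ≃ₗ[k] (op Y ⟶ op X) where
  toFun f := f.op
  invFun f := f.unop
  map_add' _ _ := rfl
  map_smul' _ _ := rfl
  left_inv _ := rfl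
  right_inv _ := rfl

variable (k) in
/-- `D(A^{op}(-, Y)) = D A(Y, -)`. -/
def dualModRepresentable (Y : A) : dualMod (representable k (op Y)) ≅ dualRepr k Y :=
  have : IsIso (mkHom (fun X => (opₗ (k := k) Y X).dualMap.toLinearMap) fun _ _ => rfl :
      dualMod (representable k (op Y)) ⟶ dualRepr k Y) :=
    (isIso_iff _).2 fun X => (opₗ (k := k) Y X).dualMap.bijective
  asIso (mkHom (fun X => (opₗ (k := k) Y X).dualMap.toLinearMap) fun _ _ => rfl)

/-- `A(-, Y) = D(D A(-, Y))`. -/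
def representableIso (hfin : ∀ X Y : A, FiniteDimensional k (X ⟶ Y)) (Y : A) :
    representable k Y ≅ dualMod (dualRepr k (op Y)) :=
  let φ : representable k Y ⟶ dualMod (dualRepr k (op Y)) :=
    mkHom (fun X => Module.Dual.eval k (op Y ⟶ op X) ∘ₗ (opₗ X Y).toLinearMap) fun _ _ => rfl
  have : IsIso φ := (isIso_iff _).2 fun X => by
    have := hfin X Y
    have : FiniteDimensional k (op Y ⟶ op X) := (opₗ (k := k) X Y).finiteDimensional
    exact (Module.evalEquiv k (op Y ⟶ op X)).bijective.comp (opₗ (k := k) X Y).bijective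
  asIso φ

end Duality

end LinMod

namespace RepCat

open FrobStable LinMod

/-! ### Modules concentrated in one degree, and self-injectivity of the repetitive category. -/

section

variable {k : Type v} [Field k] {A : Type u} [Category.{v} A] [Preadditive A] [Linear k A]

/-- The value at `Y` of the module `N` placed in degree `i`. -/
def placeSub (i : ℤ) (N : Mod k A) (Y : RepCat k A) : Submodule k (El N Y.obj) where
  carrier := {x | Y.deg ≠ i → x = 0}
  add_mem' := fun hf hg h => by simp [hf h, hg h]
  zero_mem' := fun _ => rfl
  smul_mem' := fun r f hf h => by simp [hf h]

theorem act_mem_placeSub {i : ℤ} {N : Mod k A} {Y Z : RepCat k A} (a : Z ⟶ Y) (x : El N Y.obj)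
    (hx : x ∈ placeSub i N Y) : act N a.1.1 x ∈ placeSub i N Z := fun h => by
  by_cases h' : Y.deg = i
  · rw [show a.1.1 = 0 from a.2.1 (by omega), act_zero]
  · rw [show x = 0 from hx h', map_zero]

/-- The `A`-module `N`, placed in degree `i`, as a module over the repetitive category. -/
def place (i : ℤ) (N : Mod k A) : Mod k (RepCat k A) :=
  ⟨{ obj := fun Y => ModuleCat.of k (placeSub i N Y.unop)
     map := fun a => ModuleCat.ofHom
      ((act N a.unop.1.1).restrict (act_mem_placeSub a.unop))
     map_id := fun Y => by ext x; exact act_id N _ x.1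
     map_comp := fun a b => by
      ext x; exact act_comp N a.unop.1.1 b.unop.1.1 x.1 },
   ⟨⟨fun {Y Z a b} => by
      ext x
      exact act_add N a.unop.1.1 b.unop.1.1 x.1⟩,
    ⟨fun a r => by
      ext x
      exact act_smul N r a.unop.1.1 x.1⟩⟩⟩

variable (k A) in
/-- Placing `A`-modules in degree `i`, as a functor. -/
def placeFunctor (i : ℤ) : Mod k A ⥤ Mod k (RepCat k A) where
  obj := place i
  map f := mkHom (fun Y => (ap f Y.obj).restrict (p := placeSub i _ Y) (q := placeSub i _ Y)
    fun x hx h => by rw [show x = 0 from hx h, map_zero]) fun a x =>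
      Subtype.ext (ap_act f a.1.1 x.1)
  map_id _ := rfl
  map_comp _ _ := rfl

theorem layer_eq_place (i : ℤ) (X : A) : layer k i X = place i (representable k X) := rfl

theorem isSES_place {M N L : Mod k A} {f : M ⟶ N} {g : N ⟶ L} (h : IsSES f g) (i : ℤ) :
    IsSES ((placeFunctor k A i).map f) ((placeFunctor k A i).map g) := by
  rw [isSES_iff] at h ⊢
  intro Y
  obtain ⟨h₁, h₂, h₃⟩ := h Y.obj
  refine ⟨fun x y hxy => Subtype.ext (h₁ (congr_arg Subtype.val hxy)), fun y => ⟨fun hy => ?_, ?_⟩,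
    fun y => ?_⟩
  · by_cases hi : Y.deg = i
    · obtain ⟨x, hx⟩ := (h₂ y.1).1 (congr_arg Subtype.val hy)
      exact ⟨⟨x, fun h => (h hi).elim⟩, Subtype.ext hx⟩
    · exact ⟨0, Subtype.ext ((map_zero _).trans (y.2 hi).symm)⟩
  · rintro ⟨x, rfl⟩
    exact Subtype.ext ((h₂ _).2 ⟨x.1, rfl⟩)
  · by_cases hi : Y.deg = i
    · obtain ⟨x, hx⟩ := h₃ y.1
      exact ⟨⟨x, fun h => (h hi).elim⟩, Subtype.ext hx⟩
    · exact ⟨0, Subtype.ext ((map_zero _).trans (y.2 hi).symm)⟩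

variable (k A) in
/-- The restriction of modules over the repetitive category to `A_j`. -/
def restr (j : ℤ) : Mod k (RepCat k A) ⥤ Mod k A where
  obj M := ⟨(incl k j).op ⋙ M.obj, by have := M.property.1; infer_instance,
    ⟨fun f r => by
      have := M.property.2
      change M.obj.map ((incl k j).map (r • f.unop)).op = _
      rw [Functor.map_smul, op_op_smul, Functor.map_smul]
      rfl⟩⟩
  map f := mkHom (fun X => ap f ⟨X, j⟩) fun a => ap_act f ((incl k j).map a)
  map_id _ := rfl
  map_comp _ _ := rfl

theorem isSES_restr {M N L : Mod k (RepCat k A)} {f : M ⟶ N} {g : N ⟶ L} (h : IsSES f g) (j : ℤ) :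
    IsSES ((restr k A j).map f) ((restr k A j).map g) := by
  rw [isSES_iff] at h ⊢
  exact fun X => h ⟨X, j⟩

/-- The restriction to `A_i` of an `A`-module placed in degree `i`. -/
def restrPlace (i : ℤ) (N : Mod k A) : (restr k A i).obj (place i N) ≅ N :=
  let φ : (restr k A i).obj (place i N) ⟶ N :=
    mkHom (fun X => (placeSub i N ⟨X, i⟩).subtype) fun _ _ => rfl
  have : IsIso φ := (isIso_iff _).2 fun _ => ⟨Subtype.val_injective,
    fun x => ⟨⟨x, fun h => (h rfl).elim⟩, rfl⟩⟩
  asIso φ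

theorem place_eq_zero {i : ℤ} {N : Mod k A} {Y : RepCat k A} (h : Y.deg ≠ i)
    (x : El (place i N) Y) : x = 0 := Subtype.ext (x.2 h)

theorem isZero_restr_place {i j : ℤ} (h : j ≠ i) (N : Mod k A) :
    IsZero ((restr k A j).obj (place i N)) :=
  (isZero_iff _).2 fun _ x => place_eq_zero (Y := ⟨_, j⟩) h x

/-- The representable at (X, i+1) lives in degrees i and i+1, with values D A(X,-) and A(-,X).
Morphisms of the category never lower the degree, so the contravariant action never raises it and
the part of degree i is a submodule. This sequence is the only link used between neighbouring
layers. -/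
theorem isSES_representable (i : ℤ) (X : A) :
    ∃ (f : place i (dualRepr k X) ⟶ representable k (⟨X, i + 1⟩ : RepCat k A))
      (g : representable k (⟨X, i + 1⟩ : RepCat k A) ⟶ place (i + 1) (representable k X)),
      IsSES f g := by
  refine ⟨mkHom (fun Y =>
    { toFun := fun φ => (show Y ⟶ ⟨X, i + 1⟩ from
        ⟨(0, φ.1), fun _ => rfl, fun h => φ.2 fun h' => h (congr_arg (· + 1) (Eq.symm h'))⟩)
      map_add' := fun _ _ => hom_ext (add_zero 0).symm fun _ => rfl
      map_smul' := fun r _ => hom_ext (smul_zero r).symm fun _ => rfl }) fun {Y Z} a φ => ?_,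
    mkHom (fun Y =>
      { toFun := fun p => ⟨(show Y ⟶ ⟨X, i + 1⟩ from p).1.1,
          fun h => (show Y ⟶ ⟨X, i + 1⟩ from p).2.1 h⟩
        map_add' := fun _ _ => rfl
        map_smul' := fun _ _ => rfl }) fun _ _ => rfl, (isSES_iff _ _).2 fun Y => ⟨?_, ?_, ?_⟩⟩
  · refine hom_ext (X := Z) (Y := ⟨X, i + 1⟩) comp_zero.symm fun h => ?_
    change (show Module.Dual k (X ⟶ Y.obj) from φ.1) (h ≫ a.1.1) =
      (show Module.Dual k (X ⟶ Y.obj) from φ.1) (h ≫ a.1.1) + a.1.2 ((0 : Y.obj ⟶ X) ≫ h)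
    rw [zero_comp, map_zero, add_zero]
  · intro φ ψ h
    exact Subtype.ext (congr_arg (fun a : Y ⟶ ⟨X, i + 1⟩ => a.1.2) h)
  · intro p
    constructor
    · intro hp
      have h1 : (show Y ⟶ ⟨X, i + 1⟩ from p).1.1 = 0 := congr_arg Subtype.val hp
      refine ⟨⟨(show Y ⟶ ⟨X, i + 1⟩ from p).1.2, fun h =>
        (show Y ⟶ ⟨X, i + 1⟩ from p).2.2 fun h' => h ?_⟩, ?_⟩
      · exact (add_right_cancel h').symm
      · exact hom_ext (X := Y) (Y := ⟨X, i + 1⟩) h1.symm fun _ => rfl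
    · rintro ⟨φ, rfl⟩
      rfl
  · intro x
    exact ⟨(show Y ⟶ ⟨X, i + 1⟩ from ⟨(x.1, 0), x.2, fun _ => rfl⟩), rfl⟩

/-- `R(-, (X, i + 1)) = D R((X, i), -)`. -/
theorem nonempty_representable_iso (hfin : ∀ X Y : A, FiniteDimensional k (X ⟶ Y)) (i : ℤ) (X : A) :
    Nonempty (representable k (⟨X, i + 1⟩ : RepCat k A) ≅ dualRepr k (⟨X, i⟩ : RepCat k A)) := by
  -- Morphisms p and b are paired by evaluating the D A(X,X)-component of b ≫ p at the identity of
  -- X.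
  let φ : representable k (⟨X, i + 1⟩ : RepCat k A) ⟶ dualRepr k (⟨X, i⟩ : RepCat k A) :=
    mkHom (fun Y =>
      { toFun := fun p => (show Module.Dual k ((⟨X, i⟩ : RepCat k A) ⟶ Y) from
          { toFun := fun b => (b ≫ (show Y ⟶ ⟨X, i + 1⟩ from p)).1.2 (𝟙 X)
            map_add' := fun b c => by rw [Preadditive.add_comp]; rfl
            map_smul' := fun r b => by rw [Linear.smul_comp]; rfl })
        map_add' := fun p q => LinearMap.ext fun b => by
          change (b ≫ ((show Y ⟶ ⟨X, i + 1⟩ from p) + (show Y ⟶ ⟨X, i + 1⟩ from q))).1.2 (𝟙 X) = _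
          rw [Preadditive.comp_add]; rfl
        map_smul' := fun r p => LinearMap.ext fun b => by
          change (b ≫ (r • (show Y ⟶ ⟨X, i + 1⟩ from p))).1.2 (𝟙 X) = _
          rw [Linear.comp_smul]; rfl }) fun {Y Z} a p => LinearMap.ext fun b => by
      change (b ≫ a ≫ (show Y ⟶ ⟨X, i + 1⟩ from p)).1.2 (𝟙 X) =
        ((b ≫ a) ≫ (show Y ⟶ ⟨X, i + 1⟩ from p)).1.2 (𝟙 X)
      rw [assoc]
  -- In degree i only the first summand survives, and the pairing is evaluation of D A(X,Y) on
  -- A(X,Y). In degree i+1 only the second survives, and φ is the map from A(Y,X) to its bidual,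
  -- bijective by finite dimension. In all other degrees both sides are zero.
  have hφ : ∀ (Y : RepCat k A) (p : Y ⟶ ⟨X, i + 1⟩) (b : ⟨X, i⟩ ⟶ Y),
      (show Module.Dual k ((⟨X, i⟩ : RepCat k A) ⟶ Y) from ap φ Y p) b =
        p.1.2 b.1.1 + b.1.2 p.1.1 := fun Y p b => by
    change (b ≫ p).1.2 (𝟙 X) = _
    rw [comp_snd]
    simp
  have : IsIso φ := by
    rw [isIso_iff]
    rintro ⟨Y, j⟩
    have := hfin X Y
    have := hfin Y X
    constructor
    · rw [injective_iff_map_eq_zero]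
      intro p hp
      have hp' : ∀ b : (⟨X, i⟩ : RepCat k A) ⟶ ⟨Y, j⟩,
          (show (⟨Y, j⟩ : RepCat k A) ⟶ ⟨X, i + 1⟩ from p).1.2 b.1.1 +
          b.1.2 (show (⟨Y, j⟩ : RepCat k A) ⟶ ⟨X, i + 1⟩ from p).1.1 = 0 := fun b => by
        rw [← hφ, hp]; rfl
      by_cases h0 : j = i
      · subst h0
        refine hom_ext (X := ⟨Y, j⟩) (Y := ⟨X, j + 1⟩)
          ((show (⟨Y, j⟩ : RepCat k A) ⟶ ⟨X, j + 1⟩ from p).2.1 (by simp)) fun g => ?_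
        have := hp' ((homSame X Y j).symm g)
        simp only [homSame, LinearEquiv.coe_symm_mk, LinearMap.zero_apply, add_zero] at this
        exact this
      by_cases h1 : j = i + 1
      · subst h1
        refine hom_ext (X := ⟨Y, i + 1⟩) (Y := ⟨X, i + 1⟩) ?_ fun g => ?_
        · refine (Module.forall_dual_apply_eq_zero_iff k _).1 fun ψ => ?_
          simpa [homSucc] using hp' ((homSucc X Y i).symm ψ)
        · rw [(show (⟨Y, i + 1⟩ : RepCat k A) ⟶ ⟨X, i + 1⟩ from p).2.2 (by simp)]
          rfl
      · exact hom_eq_zero (X := ⟨Y, j⟩) (Y := ⟨X, i + 1⟩) (fun h => h1 h.symm)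
          (fun h => h0 (add_right_cancel h).symm) p
    · intro l
      by_cases h0 : j = i
      · subst h0
        refine ⟨(homSucc Y X j).symm (
          (show Module.Dual k ((⟨X, j⟩ : RepCat k A) ⟶ ⟨Y, j⟩) from l) ∘ₗ
          (homSame X Y j).symm.toLinearMap), LinearMap.ext fun b => ?_⟩
        refine (hφ _ _ _).trans ?_
        obtain ⟨g, rfl⟩ := (homSame X Y j).symm.surjective b
        exact add_zero (M := k) _
      by_cases h1 : j = i + 1
      · subst h1
        refine ⟨(homSame Y X (i + 1)).symm ((Module.evalEquiv k (Y ⟶ X)).symm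
          ((show Module.Dual k ((⟨X, i⟩ : RepCat k A) ⟶ ⟨Y, i + 1⟩) from l) ∘ₗ
          (homSucc X Y i).symm.toLinearMap)), LinearMap.ext fun b => ?_⟩
        refine (hφ _ _ _).trans ?_
        obtain ⟨g, rfl⟩ := (homSucc X Y i).symm.surjective b
        have := Module.apply_evalEquiv_symm_apply k (Y ⟶ X) g
          ((show Module.Dual k ((⟨X, i⟩ : RepCat k A) ⟶ ⟨Y, i + 1⟩) from l) ∘ₗ
          (homSucc X Y i).symm.toLinearMap)
        refine Eq.trans ?_ this
        exact zero_add _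
      · refine ⟨0, LinearMap.ext fun b => ?_⟩
        rw [show b = 0 from hom_eq_zero (X := ⟨X, i⟩) (Y := ⟨Y, j⟩) h0 h1 b]
        exact (map_zero (show Module.Dual k ((⟨X, i⟩ : RepCat k A) ⟶ ⟨Y, j⟩) from _)).trans
          (map_zero (show Module.Dual k ((⟨X, i⟩ : RepCat k A) ⟶ ⟨Y, j⟩) from l)).symm
  exact ⟨asIso φ⟩

theorem injective_representable (hfin : ∀ X Y : A, FiniteDimensional k (X ⟶ Y)) (X : RepCat k A) :
    Injective (representable k X) := by
  obtain ⟨X, j⟩ := X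
  obtain ⟨i, rfl⟩ : ∃ i, j = i + 1 := ⟨j - 1, by ring⟩
  obtain ⟨e⟩ := nonempty_representable_iso hfin i X
  exact Injective.of_iso e.symm inferInstance

theorem injective_of_proj (hfin : ∀ X Y : A, FiniteDimensional k (X ⟶ Y))
    (M : Mod k (RepCat k A)) (hM : proj k (RepCat k A) M) : Injective M :=
  proj_le (T := fun M => Injective M) (fun _ h => h.injective)
    (fun _ _ _ _ => inferInstance) (fun r h => ⟨fun g f _ =>
      ⟨Injective.factorThru (g ≫ r.i) f ≫ r.r,
      by rw [← assoc, Injective.comp_factorThru, assoc, r.retract, comp_id]⟩⟩)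
    (injective_representable hfin) M hM

end

end RepCat

namespace LinMod

open FrobStable

/-! ### Covers by representables and finite projective dimension. -/

section Covers

variable {k : Type v} [Field k] {A : Type u} [Category.{v} A] [Preadditive A] [Linear k A]

theorem IsFG.exists_epi_representable [HasFiniteBiproducts A] {M : Mod k A} (h : IsFG M) :
    ∃ (X : A) (p : representable k X ⟶ M), Epi p := by
  obtain ⟨n, X, m, hm⟩ := h.exists_generators
  let x : El M (⨁ X) := ∑ j, act M (biproduct.π X j) (m j)
  have hx : ∀ i, act M (biproduct.ι X i) x = m i := fun i => by
    rw [map_sum, Finset.sum_eq_single i]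
    · rw [← act_comp, biproduct.ι_π_self, act_id]
    · intro j _ hj
      rw [← act_comp, biproduct.ι_π_ne _ hj.symm, act_zero]
    · simp
  refine ⟨⨁ X, yo x, ⟨fun f g hfg => hm _ _ _ fun i => ?_⟩⟩
  rw [yo_comp, yo_comp] at hfg
  rw [← hx, ap_act, ap_act, yo_injective hfg]

theorem isFG_of_res {M : Mod k A} (h : Res (proj k A) M) : IsFG M := by
  obtain ⟨K, Q, i, p, hQ, hK, h⟩ := h.hasCover
  have := h.epi
  exact hQ.1.of_epi p

/-- Supplies the generators for `res_obj_of_generators`. Finite direct sums in A allow a single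
representable as cover, and two-out-of-three keeps the kernel in mod A. -/
theorem hasCover_representable [HasFiniteBiproducts A] (N : Mod k A) (h : Res (proj k A) N) :
    HasCover (fun M => ∃ X : A, M = representable k X) (Res (proj k A)) N := by
  obtain ⟨X, p, hp⟩ := (isFG_of_res h).exists_epi_representable
  have hP := isProjClass_proj k A
  exact ⟨_, _, _, p, ⟨X, rfl⟩, hP.res_obj₁ (isSES_kernel p)
    (hP.res_of_prop (proj_representable X)) h, isSES_kernel p⟩

variable (k A) in
theorem isThickClass_hasFinitePD : IsThickClass (fun M : Mod k A => HasFinitePD M) where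
  obj₁ := by
    rintro X Y Z f g ⟨_, h⟩ ⟨m, hm⟩ ⟨n, hn⟩
    exact ⟨m + n, h.hasProjectiveDimensionLT_X₁ _
      (hasProjectiveDimensionLT_of_ge _ (m + 1) _ (by omega))
      (hasProjectiveDimensionLT_of_ge _ (n + 1) _ (by omega))⟩
  obj₂ := by
    rintro X Y Z f g ⟨_, h⟩ ⟨m, hm⟩ ⟨n, hn⟩
    exact ⟨m + n, h.hasProjectiveDimensionLT_X₂ _
      (hasProjectiveDimensionLT_of_ge _ (m + 1) _ (by omega))
      (hasProjectiveDimensionLT_of_ge _ (n + 1) _ (by omega))⟩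
  obj₃ := by
    rintro X Y Z f g ⟨_, h⟩ ⟨m, hm⟩ ⟨n, hn⟩
    exact ⟨m + n + 1, h.hasProjectiveDimensionLT_X₃ _
      (hasProjectiveDimensionLT_of_ge _ (m + 1) _ (by omega))
      (hasProjectiveDimensionLT_of_ge _ (n + 1) _ (by omega))⟩
  retract := by
    rintro X Y r ⟨n, hn⟩
    exact ⟨n, r.hasProjectiveDimensionLT _⟩

theorem hasFinitePD_of_projective (M : Mod k A) [Projective M] : HasFinitePD M :=
  ⟨0, inferInstance⟩

/-- A thick class that contains the finitely generated projective modules contains all the modules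
of `mod A` of finite projective dimension. -/
theorem mem_of_hasFinitePD {T : ObjectProperty (Mod k A)} (hT : IsThickClass T)
    (h : proj k A ≤ T) {M : Mod k A} (hM : Res (proj k A) M) (hM' : HasFinitePD M) : T M := by
  obtain ⟨n, hn⟩ := hM'
  induction n generalizing M with
  | zero => exact h _ ⟨isFG_of_res hM, (projective_iff_hasProjectiveDimensionLE_zero _).2 hn⟩
  | succ n ih =>
    -- The syzygy K stays in mod A and its projective dimension is bounded by n. Membership in mod A
    -- also ensures that the last syzygy is finitely generated.
    obtain ⟨K, Q, i, p, hQ, hK, hp⟩ := hM.hasCover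
    have := hQ.2
    refine hT.obj₃ hp (ih hK ?_) (h _ hQ)
    exact (hp.2.hasProjectiveDimensionLT_X₃_iff n hQ.2).1 hn

end Covers

end LinMod

namespace RepCat

open FrobStable LinMod

/-! ### Supports, the filtration by degree, and homogeneous parts. -/

section Support

attribute [local instance] Abelian.hasFiniteBiproducts

variable {k : Type v} [Field k] {A : Type u} [Category.{v} A] [Preadditive A] [Linear k A]

/-- Modules over the repetitive category whose values vanish outside the degrees in `s`. -/
def SuppIn (s : Set ℤ) : ObjectProperty (Mod k (RepCat k A)) := fun M =>
  ∀ Y : RepCat k A, Y.deg ∉ s → ∀ x : El M Y, x = 0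

theorem SuppIn.of_mono {s : Set ℤ} {M N : Mod k (RepCat k A)} (h : SuppIn s N) (f : M ⟶ N)
    [Mono f] : SuppIn s M := fun Y hY x =>
  (mono_iff f).1 inferInstance Y (by rw [h Y hY (ap f Y x), map_zero])

theorem SuppIn.of_epi {s : Set ℤ} {M N : Mod k (RepCat k A)} (h : SuppIn s M) (f : M ⟶ N)
    [Epi f] : SuppIn s N := fun Y hY y => by
  obtain ⟨x, rfl⟩ := (epi_iff f).1 inferInstance Y y
  rw [h Y hY x, map_zero]

theorem SuppIn.ext {s : Set ℤ} {M N L : Mod k (RepCat k A)} {f : M ⟶ N} {g : N ⟶ L}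
    (h : IsSES f g) (hM : SuppIn s M) (hL : SuppIn s L) : SuppIn s N := fun Y hY y => by
  obtain ⟨x, rfl⟩ := (((isSES_iff f g).1 h Y).2.1 y).1 (hL Y hY _)
  rw [hM Y hY x, map_zero]

theorem SuppIn.subset {s t : Set ℤ} (hst : s ⊆ t) {M : Mod k (RepCat k A)} (h : SuppIn s M) :
    SuppIn t M := fun Y hY => h Y fun h => hY (hst h)

theorem suppIn_place (i : ℤ) (N : Mod k A) : SuppIn {i} (place i N) := fun _ hY =>
  place_eq_zero hY

theorem suppIn_representable (X : RepCat k A) :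
    SuppIn {X.deg - 1, X.deg} (representable k X) := fun Y hY x =>
  hom_eq_zero (X := Y) (Y := X) (fun h => hY (Or.inr h.symm))
    (fun h => hY (Or.inl (by omega))) x

theorem SuppIn.biproduct {s : Set ℤ} {n : ℕ} (M : Fin n → Mod k (RepCat k A))
    [HasBiproduct M] (h : ∀ i, SuppIn s (M i)) : SuppIn s (⨁ M) := fun Y hY x => by
  have := congr_arg (fun f => ap f Y x) (biproduct.total (f := M))
  simp only [ap_sum, ap_id] at this
  rw [← this]
  exact Finset.sum_eq_zero fun i _ => by
    rw [ap_comp, show ap (biproduct.π M i) Y x = 0 from h i Y hY _, map_zero]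

theorem SuppIn.hom_eq_zero {s t : Set ℤ} (hst : Disjoint s t) {M N : Mod k (RepCat k A)}
    (hM : SuppIn s M) (hN : SuppIn t N) (f : M ⟶ N) : f = 0 :=
  hom_ext_ap fun Y x => by
    by_cases h : Y.deg ∈ s
    · rw [hN Y (Set.disjoint_left.1 hst h) (ap f Y x), ap_zero]
    · rw [show x = 0 from hM Y h x, map_zero, map_zero]

theorem exists_suppIn_Ico {M : Mod k (RepCat k A)} (h : IsFG M) :
    ∃ (a : ℤ) (n : ℕ), SuppIn (Set.Ico a (a + n)) M := by
  obtain ⟨n, X, p, hp⟩ := h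
  obtain ⟨b, hb⟩ := (Set.finite_range fun i => (X i).deg).bddAbove
  obtain ⟨a, ha⟩ := (Set.finite_range fun i => (X i).deg).bddBelow
  -- A representable at degree d also lives in degree d - 1, so the degrees range from a - 1 to b.
  -- The truncation `toNat` is needed because the bounds are arbitrary when there are no generators.
  refine ⟨a - 1, (b - a + 2).toNat, SuppIn.of_epi (SuppIn.biproduct _ fun i =>
    (suppIn_representable (X i)).subset ?_) p⟩
  have h1 := hb ⟨i, rfl⟩
  have h2 := ha ⟨i, rfl⟩
  dsimp only at h1 h2
  rintro j (rfl | rfl) <;> constructor <;> omega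

/-- The morphism `(Y, j) ⟶ (Y, a)` that is the identity if `j = a` and zero otherwise. -/
def toDeg (a : ℤ) (Y : RepCat k A) : Y ⟶ ⟨Y.obj, a⟩ :=
  ⟨(if Y.deg = a then 𝟙 _ else 0, 0), fun h => if_neg h, fun _ => rfl⟩

theorem toDeg_self (a : ℤ) (X : A) : toDeg a (⟨X, a⟩ : RepCat k A) = 𝟙 _ :=
  hom_ext (if_pos rfl) fun _ => rfl

theorem toDeg_of_ne {a : ℤ} {Y : RepCat k A} (h : Y.deg ≠ a) : toDeg a Y = 0 :=
  hom_ext (if_neg h) fun _ => rfl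

/-- If `M` vanishes in degrees less than `a`, then its part of degree `a` is a submodule. -/
def placeRestrTo {M : Mod k (RepCat k A)} {a : ℤ} (h : SuppIn (Set.Ici a) M) :
    place a ((restr k A a).obj M) ⟶ M :=
  mkHom (fun Y => act M (toDeg a Y) ∘ₗ (placeSub a ((restr k A a).obj M) Y).subtype)
    fun {Y Z} c x => by
      by_cases hZ : Z.deg < a
      · exact (h Z (by simpa using hZ) _).trans (h Z (by simpa using hZ) _).symm
      obtain ⟨Y, j⟩ := Y
      by_cases hY : j = a
      · subst hY
        obtain ⟨b, hb⟩ : ∃ b : (⟨Z.obj, j⟩ : RepCat k A) ⟶ ⟨Y, j⟩, b = (incl k j).map c.1.1 :=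
          ⟨_, rfl⟩
        have e : toDeg j Z ≫ b = c ≫ toDeg j ⟨Y, j⟩ := by
          rw [toDeg_self, comp_id]
          by_cases hZ' : Z.deg = j
          · obtain ⟨Z, l⟩ := Z
            obtain rfl : l = j := hZ'
            rw [toDeg_self, id_comp, hb]
            refine hom_ext rfl fun f => ?_
            rw [c.2.2 (by simp)]
            rfl
          · rw [toDeg_of_ne hZ', zero_comp]
            -- Here Z has degree greater than j, and morphisms do not lower the degree.
            exact (RepCat.hom_eq_zero (fun h => hZ' h.symm) (by dsimp only; omega) c).symm
        have key : ∀ y : El M ⟨Y, j⟩, act M (toDeg j Z) (act M b y) =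
            act M c (act M (toDeg j ⟨Y, j⟩) y) := fun y => by
          rw [← act_comp, ← act_comp, e]
        subst hb
        exact key x.1
      · rw [place_eq_zero (Y := ⟨Y, j⟩) hY x]
        simp only [map_zero]

theorem placeRestrTo_bijective {M : Mod k (RepCat k A)} {a : ℤ} (h : SuppIn (Set.Ici a) M) (X : A) :
    Function.Bijective (ap (placeRestrTo h) ⟨X, a⟩) := by
  have : ∀ x : El (place a ((restr k A a).obj M)) ⟨X, a⟩, ap (placeRestrTo h) ⟨X, a⟩ x = x.1 :=
    fun x => by
      have key : ∀ y : El M ⟨X, a⟩, act M (toDeg a ⟨X, a⟩) y = y := fun y => by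
        rw [toDeg_self, act_id]
      exact key x.1
  constructor
  · intro x y hxy
    rw [this, this] at hxy
    exact Subtype.ext hxy
  · exact fun y => ⟨⟨y, fun h => (h rfl).elim⟩, this _⟩

theorem mono_placeRestrTo {M : Mod k (RepCat k A)} {a : ℤ} (h : SuppIn (Set.Ici a) M) :
    Mono (placeRestrTo h) := by
  rw [mono_iff]
  rintro ⟨X, j⟩
  by_cases hj : j = a
  · subst hj
    exact (placeRestrTo_bijective h X).1
  · intro x y _
    rw [place_eq_zero (Y := ⟨X, j⟩) hj x, place_eq_zero (Y := ⟨X, j⟩) hj y]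

theorem restr_place_mem {T : ObjectProperty (Mod k A)} (hT : IsThickClass T) {N : Mod k A}
    (hN : T N) (i j : ℤ) : T ((restr k A j).obj (place i N)) := by
  by_cases h : j = i
  · subst h
    exact hT.iso (restrPlace j N).symm hN
  · exact hT.zero hN (isZero_restr_place h N)

theorem restr_representable_mem {T : ObjectProperty (Mod k A)} (hT : IsThickClass T)
    (h : ∀ X, T (representable k X)) (h' : ∀ X, T (dualRepr k X)) (j : ℤ) (X : RepCat k A) :
    T ((restr k A j).obj (representable k X)) := by
  obtain ⟨X, i⟩ := X
  obtain ⟨i, rfl⟩ : ∃ l, i = l + 1 := ⟨i - 1, by ring⟩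
  obtain ⟨f, g, hfg⟩ := isSES_representable (k := k) i X
  exact hT.obj₂ (isSES_restr hfg j) (restr_place_mem hT (h' X) i j)
    (restr_place_mem hT (h X) (i + 1) j)

/-- Each homogeneous part of a representable is, up to isomorphism, a representable, some D A(X,-)
or zero. Taking T to be `Res` uses (IFP); taking T to be finite projective dimension uses (G). -/
theorem restr_proj_mem {T : ObjectProperty (Mod k A)} (hT : IsThickClass T)
    (h : proj k A ≤ T) (h' : ∀ X, T (dualRepr k X)) (j : ℤ) {Q : Mod k (RepCat k A)}
    (hQ : proj k (RepCat k A) Q) : T ((restr k A j).obj Q) := by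
  obtain ⟨Z, hZ⟩ := HasZeroObject.zero (C := Mod k A)
  have hZ' := h _ ((isProjClass_proj k A).zero _ hZ)
  refine proj_le_of_isThickClass
    (hT.preimage (restr k A j) fun h => isSES_restr h j) (fun Y hY => ?_)
    (restr_representable_mem hT (fun X => h _ (proj_representable X)) h' j) Q hQ
  exact hT.zero hZ' ((isZero_iff _).2 fun X => (isZero_iff Y).1 hY ⟨X, j⟩)

/-- The filtration of a module over the repetitive category by degree. -/
theorem mem_of_restr_mem {T : ObjectProperty (Mod k (RepCat k A))} (hT : IsThickClass T)
    {W : ObjectProperty (Mod k A)} (hW : IsThickClass W) (h : ∀ N, W N → ∀ j, T (place j N))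
    {M : Mod k (RepCat k A)} (hM : ∀ j, W ((restr k A j).obj M)) {a : ℤ} {n : ℕ}
    (hs : SuppIn (Set.Ico a (a + n)) M) : T M := by
  induction n generalizing a M with
  | zero =>
    refine hT.zero (h _ (hM 0) 0) ((isZero_iff M).2 fun Y => hs Y ?_)
    simp
  | succ n ih =>
    have hs' : SuppIn (Set.Ici a) M := hs.subset Set.Ico_subset_Ici_self
    have := mono_placeRestrTo hs'
    -- The part of lowest degree a is split off as a submodule. The quotient is supported in one
    -- degree less, starting at a + 1.
    have hc := isSES_cokernel (placeRestrTo hs')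
    refine hT.obj₂ hc (h _ (hM a) a) (ih (a := a + 1) (fun j =>
      hW.obj₃ (isSES_restr hc j) (restr_place_mem hW (hM a) a j) (hM j)) ?_)
    rintro ⟨X, j⟩ hj x
    have hc' := (isSES_iff _ _).1 hc ⟨X, j⟩
    obtain ⟨y, rfl⟩ := hc'.2.2 x
    by_cases hja : j = a
    · subst hja
      exact (hc'.2.1 y).2 ((placeRestrTo_bijective hs' X).2 y)
    · rw [hs ⟨X, j⟩ (fun h => hj ?_) y, map_zero]
      obtain ⟨h₁, h₂⟩ := h
      dsimp only at h₁ h₂ ⊢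
      push_cast at h₂
      constructor <;> omega

/-- A finitely generated module has only finitely many nonzero homogeneous parts, so `rho M` is
their finite direct sum and the projective dimensions of the parts are bounded together. -/
theorem hasFinitePD_rho_iff {M : Mod k (RepCat k A)} (h : IsFG M) :
    HasFinitePD (rho M) ↔ ∀ j, HasFinitePD ((restr k A j).obj M) := by
  have hT := isThickClass_hasFinitePD k A
  classical
  let ι : ∀ j, (restr k A j).obj M ⟶ rho M := fun j =>
    mkHom (fun X => DirectSum.lof k ℤ (fun i => El M ⟨X, i⟩) j) fun a x =>
      (DirectSum.lmap_lof (fun i => act M ((incl k i).map a)) j x).symm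
  let π : ∀ j, rho M ⟶ (restr k A j).obj M := fun j =>
    mkHom (fun X => DirectSum.component k ℤ (fun i => El M ⟨X, i⟩) j) fun a x =>
      DirectSum.lmap_apply (fun i => act M ((incl k i).map a)) x j
  have h₁ : ∀ j, ι j ≫ π j = 𝟙 _ := fun j => hom_ext_ap fun X x =>
    DirectSum.component.lof_self k (M := fun i => El M ⟨X, i⟩) j x
  have h₂ : ∀ i j, i ≠ j → ι i ≫ π j = 0 := fun i j hij => hom_ext_ap fun X x =>
    (DirectSum.component.of k (M := fun i => El M ⟨X, i⟩) j i x).trans (dif_neg hij)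
  constructor
  · intro hM j
    exact hT.retract ⟨ι j, π j, h₁ j⟩ hM
  · intro hM
    obtain ⟨a, n, hs⟩ := exists_suppIn_Ico h
    refine hT.retract (Y := ⨁ fun i : Fin n => (restr k A (a + i)).obj M)
      ⟨biproduct.lift fun i : Fin n => π (a + i), biproduct.desc fun i : Fin n => ι (a + i), ?_⟩
      (prop_biproduct (T := fun N : Mod k A => HasFinitePD N) (fun X hX => hT.zero (hM 0) hX) hT.iso
        (fun _ _ => hT.biprod) _ fun i => hM _)
    have hπ : ∀ {f g : rho M ⟶ rho M}, (∀ j, f ≫ π j = g ≫ π j) → f = g := fun {f g} hfg =>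
      hom_ext_ap fun X x => DirectSum.ext_component k fun j =>
        congr_arg (fun q : rho M ⟶ (restr k A j).obj M => ap q X x) (hfg j)
    rw [biproduct.lift_desc]
    refine hπ fun j => ?_
    rw [Preadditive.sum_comp, id_comp]
    by_cases hj : j ∈ Set.Ico a (a + n)
    · obtain ⟨m, hm, rfl⟩ : ∃ m : ℕ, m < n ∧ j = a + m :=
        ⟨(j - a).toNat, by have := hj.1; have := hj.2; omega, by have := hj.1; omega⟩
      rw [Finset.sum_eq_single (⟨m, hm⟩ : Fin n)]
      · rw [assoc, h₁, comp_id]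
      · intro i _ hi
        rw [assoc, h₂ _ _ fun h => hi (Fin.ext (by simpa using h)), comp_zero]
      · simp
    · have hz : IsZero ((restr k A j).obj M) := (isZero_iff _).2 fun X => hs ⟨X, j⟩ hj
      exact hz.eq_of_tgt _ _

end Support

end RepCat

namespace RepCat

open FrobStable LinMod

/-! ### Gorenstein-projectivity of the layers, Frobenius structure and tilting. -/

section Tilting

variable {k : Type v} [Field k] {A : Type u} [Category.{v} A] [Preadditive A] [Linear k A]

attribute [local instance] Abelian.hasFiniteBiproducts

variable (k A) in
theorem isProjClass_op (hfin : ∀ X Y : A, FiniteDimensional k (X ⟶ Y)) :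
    IsProjClass (proj k (RepCat k A)).op :=
  (isProjClass_proj k (RepCat k A)).op (injective_of_proj hfin)

/-- The module A(-,X) in degree i+1 is covered by R(-, (X, i+1)) with kernel D A(X,-) in degree i,
again a placed module of mod A by (IFP). The coinduction therefore runs over all degrees at once. -/
theorem res_place [HasFiniteBiproducts A] (hA : IFP k A) (i : ℤ) {N : Mod k A}
    (hN : Res (proj k A) N) : Res (proj k (RepCat k A)) (place i N) := by
  rw [IFP, fpInf_eq_res] at hA
  refine (isProjClass_proj k (RepCat k A)).res_obj_of_generators (B := Mod k A)
    (fun i N => place i N) (fun j X Y Z f g h => ⟨_, _, isSES_place h j⟩) _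
    hasCover_representable ?_ i N hN
  rintro j _ ⟨X, rfl⟩
  obtain ⟨i, rfl⟩ : ∃ i, j = i + 1 := ⟨j - 1, by ring⟩
  obtain ⟨f, g, h⟩ := isSES_representable (k := k) i X
  exact ⟨_, _, f, g, proj_representable _, ⟨i, _, hA X, rfl⟩, h⟩

/-- Restricting a projective resolution to degree j gives terms that need not be projective, but are
in mod A by (IFP). That is enough for coinduction up to extensions. -/
theorem res_restr (hA : IFP k A) (j : ℤ) {M : Mod k (RepCat k A)}
    (hM : Res (proj k (RepCat k A)) M) : Res (proj k A) ((restr k A j).obj M) := by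
  rw [IFP, fpInf_eq_res] at hA
  have hP := isProjClass_proj k A
  refine hP.le_res (S := fun N => ∃ M, Res (proj k (RepCat k A)) M ∧ N = (restr k A j).obj M)
    ?_ _ ⟨M, hM, rfl⟩
  rintro _ ⟨M, hM, rfl⟩
  obtain ⟨K, Q, i, p, hQ, hK, hp⟩ := hM.hasCover
  exact ⟨_, _, _, _, .of _ (Or.inl ⟨K, hK, rfl⟩), restr_proj_mem hP.isThickClass_res
    (fun _ h => hP.res_of_prop h) hA j hQ, isSES_restr hp j⟩

/-- The mirror image of `res_place`. The dual of a representable over the opposite category is D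
A(Y,-), which embeds in R(-, (Y, j+1)) with cokernel A(-,Y) = D(D A(-,Y)) in degree j+1. By (IFP)
for the opposite category this is the placed dual of a module of mod Aᵒᵖ. -/
theorem res_op_place_dualMod [HasFiniteBiproducts A]
    (hfin : ∀ X Y : A, FiniteDimensional k (X ⟶ Y)) (hA : IFP k Aᵒᵖ) (i : ℤ) {N : Mod k Aᵒᵖ}
    (hN : Res (proj k Aᵒᵖ) N) :
    Res (proj k (RepCat k A)).op (op (place i (dualMod N))) := by
  rw [IFP, fpInf_eq_res] at hA
  have : HasFiniteBiproducts Aᵒᵖ := HasFiniteBiproducts.of_hasFiniteProducts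
  refine (isProjClass_op k A hfin).res_obj_of_generators (B := Mod k Aᵒᵖ)
    (fun i N => op (place i (dualMod N)))
    (fun j X Y Z f g h => ⟨_, _, (isSES_place (isSES_dualMod h) j).op⟩) _
    hasCover_representable ?_ i N hN
  rintro j _ ⟨⟨Y⟩, rfl⟩
  obtain ⟨f, g, h⟩ := isSES_representable (k := k) j Y
  have h' := (h.comp_iso_left ((placeFunctor k A j).mapIso (dualModRepresentable k Y)))
    |>.comp_iso_right ((placeFunctor k A (j + 1)).mapIso (representableIso hfin Y))
  exact ⟨_, _, _, _, proj_representable _, ⟨j + 1, _, hA (op Y), rfl⟩, h'.op⟩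

variable (k A) in
/-- Gorenstein-projective modules over the repetitive category all of whose homogeneous parts have
finite projective dimension. -/
def gpRestr : ObjectProperty (Mod k (RepCat k A)) := fun M =>
  (Res (proj k (RepCat k A)) M ∧ Res (proj k (RepCat k A)).op (op M)) ∧
    ∀ j, HasFinitePD ((restr k A j).obj M)

theorem gpFin_eq (hfin : ∀ X Y : A, FiniteDimensional k (X ⟶ Y)) : GPFin k A = gpRestr k A := by
  ext M
  rw [GPFin, gp_iff (injective_of_proj hfin)]
  exact and_congr_right fun h => hasFinitePD_rho_iff (isFG_of_res h.1)

theorem isThickClass_gpRestr (hfin : ∀ X Y : A, FiniteDimensional k (X ⟶ Y)) :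
    IsThickClass (gpRestr k A) := by
  have h := ((isProjClass_proj k (RepCat k A)).isThickClass_res).inf
    (isProjClass_op k A hfin).isThickClass_res.unop
  have h' := fun j => (isThickClass_hasFinitePD k A).preimage (restr k A j)
    fun h => isSES_restr h j
  exact
    { obj₁ := fun s a b => ⟨h.obj₁ s a.1 b.1, fun j => (h' j).obj₁ s (a.2 j) (b.2 j)⟩
      obj₂ := fun s a b => ⟨h.obj₂ s a.1 b.1, fun j => (h' j).obj₂ s (a.2 j) (b.2 j)⟩
      obj₃ := fun s a b => ⟨h.obj₃ s a.1 b.1, fun j => (h' j).obj₃ s (a.2 j) (b.2 j)⟩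
      retract := fun r a => ⟨h.retract r a.1, fun j => (h' j).retract r (a.2 j)⟩ }

theorem proj_le_gpRestr (hfin : ∀ X Y : A, FiniteDimensional k (X ⟶ Y)) (hG : CondG k A) :
    proj k (RepCat k A) ≤ gpRestr k A := fun _ hQ =>
  ⟨⟨(isProjClass_proj k _).res_of_prop hQ, (isProjClass_op k A hfin).res_of_prop hQ⟩, fun j =>
    restr_proj_mem (isThickClass_hasFinitePD k A)
      (fun P hP => have := hP.2; hasFinitePD_of_projective P) hG j hQ⟩

theorem isFrobeniusPair (hfin : ∀ X Y : A, FiniteDimensional k (X ⟶ Y)) (hG : CondG k A) :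
    IsFrobeniusPair (proj k (RepCat k A)) (gpRestr k A) where
  projClass := isProjClass_proj k _
  injective := injective_of_proj hfin
  thick := isThickClass_gpRestr hfin
  le := proj_le_gpRestr hfin hG
  exists_cover X hX := by
    obtain ⟨K, Q, i, p, hQ, -, hp⟩ := hX.1.1.hasCover
    exact ⟨K, (isThickClass_gpRestr hfin).obj₁ hp (proj_le_gpRestr hfin hG _ hQ) hX,
      Q, i, p, hQ, hp⟩
  exists_hull X hX := by
    obtain ⟨K, Q, i, p, hQ, -, hp⟩ := hX.1.2.hasCover
    exact ⟨K.unop, (isThickClass_gpRestr hfin).obj₃ hp.unop hX (proj_le_gpRestr hfin hG _ hQ),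
      Q.unop, p.unop, i.unop, hQ, hp.unop⟩

theorem layer_mem_gpRestr [HasFiniteBiproducts A] (hfin : ∀ X Y : A, FiniteDimensional k (X ⟶ Y))
    (hA : IFP k A) (hA' : IFP k Aᵒᵖ) (i : ℤ) (X : A) : gpRestr k A (layer k i X) := by
  rw [layer_eq_place]
  refine ⟨⟨res_place hA i ((isProjClass_proj k A).res_of_prop (proj_representable X)), ?_⟩,
    restr_place_mem (isThickClass_hasFinitePD k A) (hasFinitePD_of_projective _) i⟩
  rw [IFP, fpInf_eq_res] at hA'
  -- The coresolution comes from writing A(-,X) as the dual of D A(-,X), which is in mod Aᵒᵖ.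
  refine (isProjClass_op k A hfin).isThickClass_res.iso ?_
    (res_op_place_dualMod hfin (by rwa [IFP, fpInf_eq_res]) i (hA' (op X)))
  exact ((placeFunctor k A i).mapIso (representableIso hfin X)).op

theorem layerZero_le {T : ObjectProperty (Mod k (RepCat k A))} (hT : IsThickClass T)
    (h0 : ∀ Z, IsZero Z → T Z) (h : ∀ X, T (layer k 0 X)) : layerZero k A ≤ T := by
  rintro M ⟨n, Y, hY, ⟨r⟩⟩
  refine hT.retract r (prop_biproduct h0 hT.iso (fun _ _ => hT.biprod) Y fun i => ?_)
  obtain ⟨X, hX⟩ := hY i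
  rw [hX]
  exact h X

theorem layer_mem_layerZero (X : A) : layerZero k A (layer k 0 X) :=
  ⟨1, fun _ => layer k 0 X, fun _ => ⟨X, rfl⟩, ⟨⟨biproduct.ι (fun _ : Fin 1 => layer k 0 X) 0,
    biproduct.π (fun _ : Fin 1 => layer k 0 X) 0, biproduct.ι_π_self _ _⟩⟩⟩

theorem isZero_place (i : ℤ) {Z : Mod k A} (hZ : IsZero Z) : IsZero (place i Z) :=
  (isZero_iff _).2 fun Y x => Subtype.ext ((isZero_iff Z).1 hZ Y.obj x.1)

theorem isZero_dualMod {Z : Mod k Aᵒᵖ} (hZ : IsZero Z) : IsZero (dualMod Z) :=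
  (isZero_iff _).2 fun X φ => LinearMap.ext fun x => by
    rw [show x = 0 from (isZero_iff Z).1 hZ (op X) x]
    exact (map_zero (show Module.Dual k _ from φ)).trans (LinearMap.zero_apply _).symm

/-- A thick class that contains the projective modules and the `A_0`-modules `A_0(-, X)` contains
the `A_i`-modules `A_i(-, X)` for all `i`. -/
theorem place_representable_mem {T : ObjectProperty (Mod k (RepCat k A))} (hT : IsThickClass T)
    (hP : proj k (RepCat k A) ≤ T) (hfin : ∀ X Y : A, FiniteDimensional k (X ⟶ Y))
    (hA : IFP k A) (hA' : IFP k Aᵒᵖ) (hG : CondG k A) (hG' : CondG k Aᵒᵖ)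
    (h : ∀ X, T (place 0 (representable k X))) (i : ℤ) (X : A) :
    T (place i (representable k X)) := by
  rw [IFP, fpInf_eq_res] at hA hA'
  have h0 : ∀ Z, IsZero Z → T Z := fun Z hZ => hP _ ((isProjClass_proj k _).zero _ hZ)
  induction i generalizing X with
  | zero => exact h X
  | succ i ih =>
    obtain ⟨f, g, hfg⟩ := isSES_representable (k := k) (i : ℤ) X
    have hW := hT.preimage (placeFunctor k A i) fun h => isSES_place h i
    -- A finite resolution of D A(X,-) by projectives over A puts it, in degree i, into T. The layer
    -- of degree i+1 is the cokernel in the sequence.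
    exact hT.obj₃ hfg (mem_of_hasFinitePD hW
      (proj_le_of_isThickClass hW (fun Z hZ => h0 _ (isZero_place _ hZ)) ih) (hA X) (hG X))
      (hP _ (proj_representable _))
  | pred i ih =>
    -- Going down, the sequence first gives D A(Y,-) in the lower degree as a kernel. Dualising a
    -- finite projective resolution of D A(-,X) over the opposite category then builds A(-,X) from
    -- such modules.
    have hD : ∀ Y, T (place (-i - 1) (dualRepr k Y)) := fun Y => by
      obtain ⟨f, g, hfg⟩ := isSES_representable (k := k) (-i - 1 : ℤ) Y
      refine hT.obj₁ hfg (hP _ (proj_representable _)) ?_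
      rw [sub_add_cancel]
      exact ih Y
    have hW := (hT.preimage (placeFunctor k A (-i - 1)) fun h => isSES_place h _).preimage_op
      (dualFunctor k A) fun h => isSES_dualMod h
    refine hT.iso ((placeFunctor k A (-i - 1)).mapIso (representableIso hfin X).symm)
      (mem_of_hasFinitePD hW (proj_le_of_isThickClass hW (fun Z hZ =>
        h0 _ (isZero_place _ (isZero_dualMod hZ))) ?_) (hA' (op X)) (hG' (op X)))
    rintro ⟨Y⟩
    exact hT.iso ((placeFunctor k A (-i - 1)).mapIso (dualModRepresentable k Y).symm) (hD Y)

/-- The homogeneous parts of M are in mod A and have finite projective dimension, so each, placed in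
its degree, is built from representables of that layer. The filtration by degree assembles M from
them. -/
theorem gpRestr_le_of_isThickClass {T : ObjectProperty (Mod k (RepCat k A))} (hT : IsThickClass T)
    (hP : proj k (RepCat k A) ≤ T) (hfin : ∀ X Y : A, FiniteDimensional k (X ⟶ Y))
    (hA : IFP k A) (hA' : IFP k Aᵒᵖ) (hG : CondG k A) (hG' : CondG k Aᵒᵖ)
    (h : ∀ X, T (layer k 0 X)) : gpRestr k A ≤ T := by
  intro M hM
  have hi := place_representable_mem hT hP hfin hA hA' hG hG' h
  obtain ⟨a, n, hs⟩ := exists_suppIn_Ico (isFG_of_res hM.1.1)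
  have hR := (isProjClass_proj k A).isThickClass_res
  refine mem_of_restr_mem hT (hR.inf (isThickClass_hasFinitePD k A)) (fun N hN j => ?_)
    (fun j => ⟨?_, hM.2 j⟩) hs
  · have hW := hT.preimage (placeFunctor k A j) fun h => isSES_place h j
    refine mem_of_hasFinitePD hW (proj_le_of_isThickClass hW (fun Z hZ => hP _
      ((isProjClass_proj k _).zero _ (isZero_place j hZ))) (hi j)) hN.1 hN.2
  · exact res_restr hA j hM.1.1

theorem SuppIn.retract {s : Set ℤ} {M N : Mod k (RepCat k A)} (r : Retract M N)
    (h : SuppIn s N) : SuppIn s M :=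
  h.of_mono r.i

theorem suppIn_of_layerZero {M : Mod k (RepCat k A)} (h : layerZero k A M) : SuppIn {0} M := by
  obtain ⟨n, Y, hY, ⟨r⟩⟩ := h
  refine SuppIn.retract r (SuppIn.biproduct Y fun i => ?_)
  obtain ⟨X, hX⟩ := hY i
  rw [hX]
  exact suppIn_place 0 (representable k X)

/-- Modules with a resolution by finitely generated projective modules supported in degrees in `s`
have a projective cover of the same type, if `s` is closed under predecessors. -/
theorem le_hasCover_suppIn {s : Set ℤ} (hs : ∀ j ∈ s, j - 1 ∈ s) :
    Res (proj k (RepCat k A)) ⊓ SuppIn s ≤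
      HasCover (proj k (RepCat k A)) (Res (proj k (RepCat k A)) ⊓ SuppIn s) := by
  rintro N ⟨hN, hN'⟩
  have hP := isProjClass_proj k (RepCat k A)
  -- Generators in degrees outside s vanish and can be discarded. The remaining representables reach
  -- only one degree further down, where s is still closed.
  obtain ⟨n, X, m, hm⟩ := (isFG_of_res hN).exists_generators
  obtain ⟨l, e, p, hp⟩ := isFG_of_generators (M := N) (ι := {i : Fin n // (X i).deg ∈ s})
    (fun i => X i.1) (fun i => m i.1) fun L f g hfg => hm L f g fun i => by
      by_cases hi : (X i).deg ∈ s
      · exact hfg ⟨i, hi⟩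
      · rw [hN' (X i) hi (m i), map_zero, map_zero]
  have hQ : proj k (RepCat k A) (⨁ fun i => representable k (X (e i).1)) :=
    ⟨⟨l, _, 𝟙 _, inferInstance⟩, prop_biproduct
      (T := fun M : Mod k (RepCat k A) => Projective M) (fun _ h => h.projective)
      (fun e h => Projective.of_iso e h) (fun _ _ _ _ => inferInstance) _ fun _ => inferInstance⟩
  exact ⟨_, _, _, p, hQ, ⟨hP.res_obj₁ (isSES_kernel p) (hP.res_of_prop hQ) hN,
    SuppIn.of_mono (SuppIn.biproduct _ fun i => (suppIn_representable _).subset (by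
      rintro _ (rfl | rfl)
      · exact hs _ (e i).2
      · exact (e i).2)) (kernel.ι p)⟩, isSES_kernel p⟩

/-- The first syzygy of A(-,X) in degree 0 is D A(X,-) in degree -1. From there `le_hasCover_suppIn`
keeps all further syzygies in negative degrees. -/
theorem hasCover_biproduct_layer [HasFiniteBiproducts A] (hA : IFP k A) {n : ℕ}
    (Y : Fin n → Mod k (RepCat k A)) (hY : ∀ i, ∃ X, Y i = layer k 0 X) :
    HasCover (proj k (RepCat k A)) (Res (proj k (RepCat k A)) ⊓ SuppIn (Set.Iio 0)) (⨁ Y) := by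
  have hP := isProjClass_proj k (RepCat k A)
  have hE : ∀ N, ExtCl (Res (proj k (RepCat k A)) ⊓ SuppIn (Set.Iio 0)) N →
      (Res (proj k (RepCat k A)) ⊓ SuppIn (Set.Iio 0)) N := fun N hN => by
    induction hN with
    | of _ h => exact h
    | ext f g h _ _ h₁ h₂ => exact ⟨hP.res_obj₂ h h₁.1 h₂.1, SuppIn.ext h h₁.2 h₂.2⟩
  refine prop_biproduct (fun Z hZ => le_hasCover_suppIn (fun j hj => ?_) Z
    ⟨hP.res_of_prop (hP.zero _ hZ), fun X _ => (isZero_iff Z).1 hZ X⟩) (fun e h => h.iso e)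
    (fun M N hM hN => HasCover.mono hE _ (hP.hasCover_ext (isSES_biprod M N)
      (HasCover.mono (fun _ h => .of _ h) _ hM) (HasCover.mono (fun _ h => .of _ h) _ hN))) Y
    fun i => ?_
  · simp only [Set.mem_Iio] at hj ⊢
    omega
  · obtain ⟨X, hX⟩ := hY i
    rw [hX]
    obtain ⟨f, g, h⟩ := isSES_representable (k := k) (-1) X
    rw [IFP, fpInf_eq_res] at hA
    exact ⟨_, _, f, g, proj_representable _, ⟨res_place (by rwa [IFP, fpInf_eq_res]) (-1) (hA X),
      (suppIn_place (-1) _).subset (by simp)⟩, h⟩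

theorem isTiltingIn_gpRestr [HasFiniteBiproducts A] (hfin : ∀ X Y : A, FiniteDimensional k (X ⟶ Y))
    (hA : IFP k A) (hA' : IFP k Aᵒᵖ) (hG : CondG k A) (hG' : CondG k Aᵒᵖ) :
    IsTiltingIn (layerZero k A) (gpRestr k A) := by
  have h := isFrobeniusPair hfin hG
  have hle : layerZero k A ≤ gpRestr k A := layerZero_le h.thick
    (fun Z hZ => h.le _ (h.projClass.zero _ hZ)) (layer_mem_gpRestr hfin hA hA' 0)
  refine ⟨hle, h.isFrobenius, h.isTilting h.isFrobenius _ (fun X hX => ?_) fun T hT hP hM => ?_⟩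
  · obtain ⟨n, Y, hY, ⟨r⟩⟩ := hX
    obtain ⟨K, Q, i, p, hQ, hK, hp⟩ := hasCover_biproduct_layer hA Y hY
    obtain ⟨N, hN₀, hN, hN'⟩ := exists_sequence_of_le_hasCover
      (le_hasCover_suppIn (k := k) (A := A) (s := Set.Iio 0) fun j hj => by
        simp only [Set.mem_Iio] at hj ⊢
        omega) hK
    subst hN₀
    -- The sequence starts with the direct sum of layers, of which X is a summand. Only its later
    -- terms have negative support, which is why the vanishing condition concerns `K (n + 1)`.
    refine ⟨fun n => Nat.casesOn n (⨁ Y) N, ⟨r⟩, fun n => ?_, fun n Z hZ => ?_⟩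
    · cases n with
      | zero => exact ⟨Q, i, p, hQ, hp⟩
      | succ n => exact hN' n
    · have hd : Disjoint (Set.Iio (0 : ℤ)) {0} := by simp
      exact ⟨SuppIn.hom_eq_zero hd (hN n).2 (suppIn_of_layerZero hZ),
        SuppIn.hom_eq_zero hd.symm (suppIn_of_layerZero hZ) (hN n).2⟩
  · exact gpRestr_le_of_isThickClass hT hP hfin hA hA' hG hG' fun X =>
      hM _ ⟨layer_mem_layerZero X, hle _ (layer_mem_layerZero X)⟩

end Tilting

end RepCat

end

theorem theorem3p8 {k : Type v} [Field k] {A : Type u} [Category.{v} A] [Preadditive A]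
    [Linear k A] [HasFiniteBiproducts A]
    (hfin : ∀ X Y : A, FiniteDimensional k (X ⟶ Y))
    (hA : LinMod.IFP k A) (hA' : LinMod.IFP k Aᵒᵖ) :
    (LinMod.CondG k A → LinMod.CondG k Aᵒᵖ →
      RepCat.IsTiltingIn (RepCat.layerZero k A) (RepCat.GPFin k A)) ∧
    ((∀ N : LinMod.Mod k A, LinMod.fpInf k A N → LinMod.HasFinitePD N) →
      (∀ N : LinMod.Mod k Aᵒᵖ, LinMod.fpInf k Aᵒᵖ N → LinMod.HasFinitePD N) →
      RepCat.IsTiltingIn (RepCat.layerZero k A) (LinMod.GP k (RepCat k A))) := by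
  constructor
  · intro hG hG'
    rw [RepCat.gpFin_eq hfin]
    exact RepCat.isTiltingIn_gpRestr hfin hA hA' hG hG'
  · intro hG hG'
    -- Homogeneous parts of Gorenstein-projectives are in mod A, so their projective dimension is
    -- finite by assumption. Likewise (IFP) puts D A(X,-) in mod A, and (G) follows on both sides.
    have h : LinMod.GP k (RepCat k A) = RepCat.gpRestr k A := by
      ext M
      rw [LinMod.gp_iff (RepCat.injective_of_proj hfin)]
      refine ⟨fun h => ⟨h, fun j => hG _ ?_⟩, And.left⟩
      rw [LinMod.fpInf_eq_res]
      exact RepCat.res_restr hA j h.1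
    rw [h]
    exact RepCat.isTiltingIn_gpRestr hfin hA hA' (fun X => hG _ (hA X)) fun X => hG' _ (hA' X)
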